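/- **Setting.** Let $T_h$ be a finite set of closed triangles and rectangles in $\mathbb R^2$ with pairwise disjoint interiors, and let $\mathcal D$ be the interior of their union. Assume that $T_h$ is quasi-uniform with mesh width $h>0$: each element has diameter at most $h$ and contains a disc of radius $\sigma h$. Let $\partial\mathcal D_D\subset\partial\mathcal D$. Let $X^h$ be a finite-dimensional space of vector fields on $\overline{\mathcal D}$ whose components are conforming finite element functions, that is, single-valued functions that agree on each closed element with a polynomial of total degree at most $r$. Let $X_0^h=\{v\in X^h: v=0\text{ on }\partial\mathcal D_D\}$, let $X_E^h$ be the set of $v\in X^h$ that interpolate given Dirichlet data $\vec w$ at a set of nodes on $\partial\mathcal D_D$ (where a $v\in X^h$ that vanishes at the nodes vanishes on $\partial\mathcal D_D$), and let $Y^h\subset L_2(\mathcal D)$ be finite-dimensional. Assume that $(X_0^h,Y^h)$ is div-stable: for some $\beta>0$, every $0\neq q\in Y^h$ satisfies $\max_{0\ne v\in X_0^h}\int_{\mathcal D} q\,\nabla\!\cdot v/\|v\|_{H^1}\ge\beta\|q\|_{L_2}$. Let $\nu>0$, $\vec f\in L_2(\mathcal D)^2$, and let $\vec u^{(s)}\in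 X_E^h$, $p^{(s)}\in Y^h$ be a steady solution of the discrete Navier–Stokes equations: $\nu\int\nabla\vec u^{(s)}:\nabla v+\int(\vec u^{(s)}\cdot\nabla\vec u^{(s)})\cdot v-\int p^{(s)}\,\nabla\!\cdot v=\int\vec f\cdot v$ for all $v\in X_0^h$, and $\int q\,\nabla\!\cdot\vec u^{(s)}=0$ for all $q\in Y^h$. With respect to bases $\{e_i\}$ of $X_0^h$ and $\{g_i\}$ of $Y^h$ (of dimensions $n_u$, $n_p$) let $F_{ij}=a(e_j,e_i)$, where $a(\gamma,v)=\nu\int\nabla\gamma:\nabla v+\int(\vec u^{(s)}\cdot\nabla\gamma)\cdot v+\int(\gamma\cdot\nabla\vec u^{(s)})\cdot v$, and let $B_{ij}=-\int g_i\,\nabla\!\cdot e_j$ and $Q_{ij}=\int e_i\cdot e_j$. The eigenvalues of the unperturbed problem are the $\lambda\in\mathbb C$ for which $$\begin{bmatrix}F&B^T\\B&0\end{bmatrix}\begin{bmatrix}\mathbf u\\ \mathbf p\end{bmatrix}=\lambda\begin{bmatrix}-Q&0\\0&0\end{bmatrix}\begin{bmatrix}\mathbf u\\ \mathbf p\end{bmatrix}$$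 has a nonzero solution. Assume that this problem is diagonalizable, in the sense that $\ker B\subset\mathbb C^{n_u}$ has a basis formed by the velocity parts of eigenvectors; let $V$ be the matrix whose $m$ columns are such a basis, $\lambda_1,\dots,\lambda_m$ the corresponding eigenvalues, and $\kappa=\max_{|a|=1}\|Va\|_Q\,/\min_{|a|=1}\|Va\|_Q$ its condition number, with $\|z\|_Q^2=z^*Qz$ (the squared $L_2$ norm of the velocity). Let $\phi_h$ be a scalar conforming finite element function on $T_h$ (of any degree), and on each element $k$ let $\vec\delta_h^{(k)}=(-\partial_2\phi_h|_k,\partial_1\phi_h|_k)^T$; put $\|\delta_h\|_\infty=\max_k\max_{x\in k}|\vec\delta_h^{(k)}(x)|$. For scalar functions let $$c_h(u,v)=\sum_{k\in T_h}\Big(\int_k(\vec\delta_h^{(k)}\cdot\nabla u)\,v-\tfrac12\int_{\partial k}u\,v\,\vec\delta_h^{(k)}\cdot\vec n\Big),$$ with $\vec n$ the outward unit normal; for vector fields sum over the components. Let $N_{ij}=c_h(e_i,e_j)$. For $\alpha\in\mathbb R$ the eigenvalues of the perturbed problem are the $\hat\lambda\in\mathbb C$ for which $$\begin{bmatrix}F+N&B^T\\B&0\end{bmatrix}\begin{bmatrix}\mathbf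 u\\ \mathbf p\end{bmatrix}=\hat\lambda\begin{bmatrix}-Q&\alpha B^T\\\alpha B&0\end{bmatrix}\begin{bmatrix}\mathbf u\\ \mathbf p\end{bmatrix}$$ has a nonzero solution ($\alpha=0$ is allowed). **Theorem.** There is a constant $C>0$, depending only on $r$ and $\sigma$, such that for every discretization, steady solution, $V$, $\phi_h$ and $\alpha$ as above, and every rightmost eigenvalue $\lambda$ of the unperturbed problem (one of largest real part), the perturbed problem has an eigenvalue closest to $\lambda$, and every such closest eigenvalue $\hat\lambda$ satisfies $$|\hat\lambda-\lambda|\le\frac{c}{h}\,\|\delta_h\|_\infty\qquad\text{with } c=(2m-1)\,C\kappa .$$ If moreover the perturbation is so small that $2\,\frac{C\kappa}{h}\|\delta_h\|_\infty<|\lambda_j-\lambda|$ for all $j$ with $\lambda_j\ne\lambda$, then this holds with $c=C\kappa$. -/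

import Mathlib

open MeasureTheory

noncomputable section

namespace NSPerturb

/-- The Euclidean plane. -/
abbrev Plane := EuclideanSpace ℝ (Fin 2)

/-- Counterclockwise rotation by a right angle. -/
def rotCCW (v : Plane) : Plane := !₂[-(v 1), v 0]

/-- Clockwise rotation by a right angle. -/
def rotCW (v : Plane) : Plane := !₂[v 1, -(v 0)]

/-- The scalar cross product. -/
def cross (v w : Plane) : ℝ := v 0 * w 1 - v 1 * w 0

/-- Standard basis vectors of the plane. -/
def unitVec (i : Fin 2) : Plane := EuclideanSpace.single i 1

/-- A nondegenerate triangle with counterclockwise vertices `a, b, c`, or a nondegenerate rectangle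
with counterclockwise vertices `a, a + e, a + e + t e', a + t e'`, where `e'` is `e` rotated
counterclockwise by a right angle. -/
inductive Element where
  | triangle (a b c : Plane) (pos : 0 < cross (b - a) (c - a)) : Element
  | rectangle (a e : Plane) (t : ℝ) (he : e ≠ 0) (ht : 0 < t) : Element

namespace Element

/-- The directed edges, in counterclockwise order. -/
def edges : Element → List (Plane × Plane)
  | triangle a b c _ => [(a, b), (b, c), (c, a)]
  | rectangle a e t _ _ =>
      [(a, a + e), (a + e, a + e + t • rotCCW e),
        (a + e + t • rotCCW e, a + t • rotCCW e), (a + t • rotCCW e, a)]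

/-- The closed region covered by the element. -/
def region : Element → Set Plane
  | triangle a b c _ => convexHull ℝ {a, b, c}
  | rectangle a e t _ _ =>
      convexHull ℝ {a, a + e, a + e + t • rotCCW e, a + t • rotCCW e}

/-- The flux `∫_{∂k} g · n ds` with outward unit normal `n`. On the edge from `p` to `q`
(counterclockwise), `n ds` is the clockwise rotation of `q - p` times `dτ`. -/
def boundaryFlux (k : Element) (g : Plane → Plane) : ℝ :=
  (k.edges.map fun e =>
    ∫ τ in (0 : ℝ)..1, inner ℝ (g (e.1 + τ • (e.2 - e.1))) (rotCW (e.2 - e.1))).sum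

end Element

/-- The closed set covered by a finite family of elements. -/
def cover (T : Finset Element) : Set Plane := ⋃ k ∈ T, k.region

/-- The open polygonal domain that is subdivided by the elements. -/
def domain (T : Finset Element) : Set Plane := interior (cover T)

/-- A scalar conforming finite element function of degree at most `r`: on each closed element it
is a polynomial. As it is single valued on the closed elements it is continuous on the
closure of the domain, which for piecewise polynomials is the same as belonging to `H¹`.
The total degree bounds both the `P_r` elements and (with `r = 2 s`) the `Q_s` elements. -/
def IsFEFunction (T : Finset Element) (r : ℕ) (u : Plane → ℝ) : Prop :=
  ∀ k ∈ T, ∃ p : MvPolynomial (Fin 2) ℝ, p.totalDegree ≤ r ∧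
    ∀ x ∈ k.region, u x = MvPolynomial.eval (fun i => x i) p

/-- A mixed finite element discretization with velocities of (total) degree at most `r`. -/
structure Discretization (r : ℕ) where
  /-- The elements. -/
  mesh : Finset Element
  mesh_disjoint : ∀ k ∈ mesh, ∀ l ∈ mesh, k ≠ l →
    Disjoint (interior k.region) (interior l.region)
  /-- The Dirichlet part of the boundary. -/
  dirichlet : Set Plane
  dirichlet_subset : dirichlet ⊆ frontier (domain mesh)
  /-- The velocity space, without boundary conditions. Functions on the closed domain are
  extended by zero. -/
  X : Submodule ℝ (Plane → Plane)
  X_finite : FiniteDimensional ℝ X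
  X_fe : ∀ v ∈ X, ∀ i, IsFEFunction mesh r (fun x => v x i)
  X_support : ∀ v ∈ X, ∀ x, x ∉ cover mesh → v x = 0
  /-- The element nodes that lie on the Dirichlet boundary. -/
  nodes : Set Plane
  nodes_subset : nodes ⊆ dirichlet
  nodes_unisolvent : ∀ v ∈ X, (∀ x ∈ nodes, v x = 0) → ∀ x ∈ dirichlet, v x = 0
  /-- The pressure space. -/
  Y : Submodule ℝ (Lp ℝ 2 (volume.restrict (domain mesh)))
  Y_finite : FiniteDimensional ℝ Y

/-- The divergence. -/
def div (v : Plane → Plane) (x : Plane) : ℝ := ∑ i, fderiv ℝ v x (unitVec i) i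

/-- `∇u : ∇v`. -/
def gradDot (u v : Plane → Plane) (x : Plane) : ℝ :=
  ∑ i, ∑ j, fderiv ℝ u x (unitVec j) i * fderiv ℝ v x (unitVec j) i

/-- `(w · ∇u) · v`. -/
def convDot (w u v : Plane → Plane) (x : Plane) : ℝ :=
  inner ℝ (fderiv ℝ u x (w x)) (v x)

/-- On the element `k`, the field `curl φ = (-∂φ/∂x₂, ∂φ/∂x₁)`; the derivatives are those of the
restriction of `φ` to the closed element, so that on the boundary of `k` they are the limits
from inside `k`. -/
def curlOn (φ : Plane → ℝ) (k : Element) (x : Plane) : Plane :=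
  !₂[-(fderivWithin ℝ φ k.region x (unitVec 1)), fderivWithin ℝ φ k.region x (unitVec 0)]

namespace Discretization

variable {r : ℕ} (D : Discretization r)

/-- The domain of the flow problem. -/
def dom : Set Plane := domain D.mesh

/-- The velocity space with homogeneous Dirichlet conditions. -/
def X0 : Submodule ℝ (Plane → Plane) where
  carrier := {v | v ∈ D.X ∧ ∀ x ∈ D.dirichlet, v x = 0}
  add_mem' := fun ha hb => ⟨D.X.add_mem ha.1 hb.1, fun x hx => by
    simp [ha.2 x hx, hb.2 x hx]⟩
  zero_mem' := ⟨D.X.zero_mem, fun _ _ => rfl⟩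
  smul_mem' := fun c _ ha => ⟨D.X.smul_mem c ha.1, fun x hx => by
    simp [ha.2 x hx]⟩

/-- The velocities that interpolate the Dirichlet data `w` at the nodes. -/
def XE (w : Plane → Plane) : Set (Plane → Plane) := {v | v ∈ D.X ∧ ∀ x ∈ D.nodes, v x = w x}

/-- Quasi-uniformity with mesh width `h`: every element has diameter at most `h` and contains a
disc of radius `σ h`. -/
def QuasiUniform (σ h : ℝ) : Prop :=
  ∀ k ∈ D.mesh, Metric.diam k.region ≤ h ∧ ∃ x, Metric.ball x (σ * h) ⊆ k.region

/-- The `H¹` norm of a velocity. -/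
def h1Norm (v : Plane → Plane) : ℝ :=
  Real.sqrt ((∫ x in D.dom, ‖v x‖ ^ 2) + ∫ x in D.dom, gradDot v v x)

/-- The form `∫ q div v`. -/
def divForm (q : Lp ℝ 2 (volume.restrict (domain D.mesh))) (v : Plane → Plane) : ℝ :=
  ∫ x in D.dom, q x * div v x

/-- Div-stability (the discrete inf-sup condition) with constant `β`. -/
def DivStable (β : ℝ) : Prop :=
  ∀ q ∈ D.Y, q ≠ 0 → ∃ v ∈ D.X0, 0 < D.h1Norm v ∧ β * ‖q‖ * D.h1Norm v ≤ D.divForm q v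

/-- `(u, p)` is a steady solution of the discrete weak Navier-Stokes equations with viscosity `ν`,
body force `f` and Dirichlet data `w`. -/
def IsSteadySolution (ν : ℝ) (f w u : Plane → Plane)
    (p : Lp ℝ 2 (volume.restrict (domain D.mesh))) : Prop :=
  u ∈ D.XE w ∧ p ∈ D.Y ∧
  (∀ v ∈ D.X0, ν * (∫ x in D.dom, gradDot u v x) + (∫ x in D.dom, convDot u u v x)
      - D.divForm p v = ∫ x in D.dom, inner ℝ (f x) (v x)) ∧
  ∀ q ∈ D.Y, -D.divForm q u = 0

/-- The linearized convection-diffusion form `a(γ, v; u)`. -/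
def aForm (ν : ℝ) (u γ v : Plane → Plane) : ℝ :=
  ν * (∫ x in D.dom, gradDot γ v x) + (∫ x in D.dom, convDot u γ v x)
    + ∫ x in D.dom, convDot γ u v x

/-- The element form `∫_k (δ · ∇u) v - ½ ∫_{∂k} u v δ · n` for scalar `u`, `v`, `δ = curl φ`. -/
def cElement (φ : Plane → ℝ) (k : Element) (u v : Plane → ℝ) : ℝ :=
  (∫ x in k.region, fderivWithin ℝ u k.region x (curlOn φ k x) * v x)
    - (1 / 2) * k.boundaryFlux (fun x => (u x * v x) • curlOn φ k x)

/-- The nondissipative perturbation `c_h(u, v; δ_h)`, the sum over elements and components. -/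
def cForm (φ : Plane → ℝ) (u v : Plane → Plane) : ℝ :=
  ∑ k ∈ D.mesh, ∑ i, cElement φ k (fun x => u x i) (fun x => v x i)

/-- `‖δ_h‖_∞` for the elementwise curl `δ_h` of `φ`. -/
def deltaSup (φ : Plane → ℝ) : ℝ :=
  sSup {y | ∃ k ∈ D.mesh, ∃ x ∈ k.region, y = ‖curlOn φ k x‖}

variable {nu np : ℕ}

/-- The matrix of the linearized convection-diffusion form. -/
def matF (ν : ℝ) (u : Plane → Plane) (e : Module.Basis (Fin nu) ℝ D.X0) :
    Matrix (Fin nu) (Fin nu) ℝ :=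
  Matrix.of fun i j => D.aForm ν u (e j) (e i)

/-- The negative divergence matrix. -/
def matB (e : Module.Basis (Fin nu) ℝ D.X0) (g : Module.Basis (Fin np) ℝ D.Y) :
    Matrix (Fin np) (Fin nu) ℝ :=
  Matrix.of fun i j => -D.divForm (g i) (e j)

/-- The velocity mass matrix. -/
def matQ (e : Module.Basis (Fin nu) ℝ D.X0) : Matrix (Fin nu) (Fin nu) ℝ :=
  Matrix.of fun i j =>
    ∫ x in D.dom, inner ℝ ((e i : Plane → Plane) x) ((e j : Plane → Plane) x)

/-- The perturbation matrix, `(u, N v) = c_h(u_h, v_h; δ_h)`. -/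
def matN (φ : Plane → ℝ) (e : Module.Basis (Fin nu) ℝ D.X0) : Matrix (Fin nu) (Fin nu) ℝ :=
  Matrix.of fun i j => D.cForm φ (e i) (e j)

end Discretization

section Spectral

/-- A real matrix regarded as a complex one. -/
def toC {m n : Type*} (A : Matrix m n ℝ) : Matrix m n ℂ := A.map Complex.ofReal

/-- The (finite) eigenvalues of the generalized problem `A z = μ M z`. -/
def genSpectrum {ι : Type*} [Fintype ι] (A M : Matrix ι ι ℝ) : Set ℂ :=
  {μ | ∃ z : ι → ℂ, z ≠ 0 ∧ (toC A).mulVec z = μ • (toC M).mulVec z}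

variable {nu np m : ℕ}

/-- The saddle point matrix `[F Bᵀ; B 0]`. -/
def saddle (F : Matrix (Fin nu) (Fin nu) ℝ) (B : Matrix (Fin np) (Fin nu) ℝ) :
    Matrix (Fin nu ⊕ Fin np) (Fin nu ⊕ Fin np) ℝ :=
  Matrix.fromBlocks F B.transpose B 0

/-- The mass matrix `[-Q αBᵀ; αB 0]`; `α = 0` is the unmodified one. -/
def massMat (α : ℝ) (Q : Matrix (Fin nu) (Fin nu) ℝ) (B : Matrix (Fin np) (Fin nu) ℝ) :
    Matrix (Fin nu ⊕ Fin np) (Fin nu ⊕ Fin np) ℝ :=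
  Matrix.fromBlocks (-Q) (α • B.transpose) (α • B) 0

/-- `μ` is a rightmost element of `S`. -/
def IsRightmost (S : Set ℂ) (μ : ℂ) : Prop := μ ∈ S ∧ ∀ η ∈ S, η.re ≤ μ.re

/-- `η` is an element of `S` closest to `μ`. -/
def IsClosest (S : Set ℂ) (μ η : ℂ) : Prop := η ∈ S ∧ ∀ ζ ∈ S, ‖η - μ‖ ≤ ‖ζ - μ‖

/-- Diagonalizability of the finite part of the problem
`[F Bᵀ; B 0] (u, p) = μ [-Q 0; 0 0] (u, p)`: the columns of `V` are the velocity parts of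
eigenvectors (with pressure parts the columns of `P` and eigenvalues `Λ`) and form a basis of the
discretely divergence-free coefficient vectors. -/
structure IsEigenbasis (F : Matrix (Fin nu) (Fin nu) ℝ) (B : Matrix (Fin np) (Fin nu) ℝ)
    (Q : Matrix (Fin nu) (Fin nu) ℝ) (V : Matrix (Fin nu) (Fin m) ℂ)
    (P : Matrix (Fin np) (Fin m) ℂ) (Λ : Fin m → ℂ) : Prop where
  momentum : toC F * V + toC B.transpose * P = -(toC Q * V * Matrix.diagonal Λ)
  divFree : toC B * V = 0
  injective : Function.Injective V.mulVec
  spans : ∀ z : Fin nu → ℂ, (toC B).mulVec z = 0 → ∃ a, V.mulVec a = z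

/-- The norm `(z* Q z)^{1/2}`, that is, the `L²` norm of the velocity with coefficients `z`. -/
def qNorm (Q : Matrix (Fin nu) (Fin nu) ℝ) (z : Fin nu → ℂ) : ℝ :=
  Real.sqrt (dotProduct (star z) ((toC Q).mulVec z)).re

/-- The condition number of `V` as a map from Euclidean space to the velocities with the `L²` norm
is at most `κ`. -/
def CondLE (Q : Matrix (Fin nu) (Fin nu) ℝ) (V : Matrix (Fin nu) (Fin m) ℂ) (κ : ℝ) : Prop :=
  ∀ a b : Fin m → ℂ, ∑ j, ‖a j‖ ^ 2 = ∑ j, ‖b j‖ ^ 2 →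
    qNorm Q (V.mulVec a) ≤ κ * qNorm Q (V.mulVec b)

end Spectral

end NSPerturb

end

/-! The columns of V span ker B, so multiplying the momentum equation by V* removes the pressure.
For α = 0 the perturbed problem becomes the ordinary eigenvalue problem of diag Λ + E with E =
-(V*QV)⁻¹ V*NV (`mem_genSpectrum_zero_iff_reduced`); conversely the pressure is recovered because a
residual orthogonal to ker B lies in the range of Bᵀ. A nonzero α only rescales the pressure by 1 -
μα, so it loses no eigenvalue and adds at most 1/α.

If the form of N is bounded by η in the velocity norm, then E is bounded by ε = ηκ in the Euclidean
norm (`reducedPert_bound`). By Bauer-Fike the eigenvalues of diag Λ + tE, 0 ≤ t ≤ 1, stay in the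
discs of radius ε about the Λ j. A circle about λ that misses these discs cannot be crossed as t
grows, so it still encloses an eigenvalue at t = 1 (`exists_eigenvector_in_closedBall`). Such a
circle exists with radius at most any R > (2m - 1)ε, since the forbidden radii are too few to fill
[0, R] (`exists_gap`); if the other eigenvalues are more than 2ε away, any radius slightly above ε
will do.

The value of η, a constant times ‖δ_h‖_∞ / h, comes from inverse estimates. On polynomials of degree
at most r all norms are equivalent, and scaling gives the powers of h. Each element form is bounded
by L² norms over a disc inside the element; these discs are disjoint, so Cauchy-Schwarz sums the
bounds with a constant independent of the number of elements (`exists_cForm_bound`). -/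

namespace NSPerturb

/-! ### Eigenvalues of perturbed diagonal matrices -/

section DiagonalPerturbation

variable {n : Type*} [Fintype n] [DecidableEq n]

/-- Bauer-Fike for a perturbation of a diagonal matrix in the Euclidean norm. -/
theorem exists_diag_close_of_eigenvector (Λ : n → ℂ) (E : Matrix n n ℂ) {ε t : ℝ} (hε : 0 ≤ ε)
    (hE : ∀ a, ∑ j, ‖E.mulVec a j‖ ^ 2 ≤ ε ^ 2 * ∑ j, ‖a j‖ ^ 2) (ht : |t| ≤ 1)
    {z : ℂ} {a : n → ℂ} (ha : a ≠ 0)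
    (h : (Matrix.diagonal Λ + (t : ℂ) • E).mulVec a = z • a) : ∃ j, ‖z - Λ j‖ ≤ ε := by
  by_contra! hlt
  obtain ⟨i, hi⟩ := Function.ne_iff.mp ha
  have hco : ∀ j, (z - Λ j) * a j = (t : ℂ) * E.mulVec a j := by
    intro j
    have := congrFun h j
    simp only [Matrix.add_mulVec, Matrix.smul_mulVec, Pi.add_apply, Matrix.mulVec_diagonal,
      Pi.smul_apply, smul_eq_mul] at this
    rw [sub_mul, ← this]; ring
  have hsq : ∀ j, ε ^ 2 * ‖a j‖ ^ 2 ≤ ‖(z - Λ j) * a j‖ ^ 2 := by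
    intro j
    rw [norm_mul, mul_pow]
    have := hlt j
    gcongr
  have hsq' : ε ^ 2 * ‖a i‖ ^ 2 < ‖(z - Λ i) * a i‖ ^ 2 := by
    rw [norm_mul, mul_pow]
    have := hlt i
    have h0 : 0 < ‖a i‖ := norm_pos_iff.mpr hi
    gcongr
  -- The inequality is strict because the coordinate `i` of `a` is nonzero. It contradicts the bound
  -- on `E` once the squares are summed.
  have h1 : ε ^ 2 * ∑ j, ‖a j‖ ^ 2 < ∑ j, ‖(z - Λ j) * a j‖ ^ 2 := by
    rw [Finset.mul_sum]
    exact Finset.sum_lt_sum (fun j _ => hsq j) ⟨i, Finset.mem_univ _, hsq'⟩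
  have h2 : ∑ j, ‖(z - Λ j) * a j‖ ^ 2 ≤ ∑ j, ‖E.mulVec a j‖ ^ 2 := by
    refine Finset.sum_le_sum fun j _ => ?_
    rw [hco j, norm_mul]
    have : ‖(t : ℂ)‖ ≤ 1 := by simpa using ht
    gcongr
    exact mul_le_of_le_one_left (norm_nonneg _) this
  exact absurd (h1.trans_le (h2.trans (hE a))) (lt_irrefl _)

/-- If the characteristic polynomial of `M` is small at `z`, then `M` has an eigenvalue near `z`. -/
theorem exists_eigenvalue_near (M : Matrix n n ℂ) (z : ℂ) {d : ℝ} (hd : 0 < d)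
    (h : ‖(Matrix.scalar n z - M).det‖ < d ^ Fintype.card n) :
    ∃ y, ‖z - y‖ < d ∧ (Matrix.scalar n y - M).det = 0 := by
  by_contra! hc
  rw [← Matrix.eval_charpoly,
    (IsAlgClosed.splits M.charpoly).eval_eq_prod_roots_of_monic M.charpoly_monic] at h
  have hcard : M.charpoly.roots.card = Fintype.card n := by
    rw [← (IsAlgClosed.splits M.charpoly).natDegree_eq_card_roots, M.charpoly_natDegree_eq_dim]
  -- The characteristic polynomial at `z` is the product of the distances to its n roots, up to
  -- phase. If all were at least `d`, so would be their product compared with `d ^ n`.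
  have key : ∀ s : Multiset ℂ, (∀ y ∈ s, d ≤ ‖z - y‖) →
      d ^ s.card ≤ ‖(s.map fun y => z - y).prod‖ := by
    intro s
    induction s using Multiset.induction_on with
    | empty => simp
    | cons y s ih =>
      intro hs
      rw [Multiset.card_cons, Multiset.map_cons, Multiset.prod_cons, norm_mul, pow_succ']
      have h1 := hs y (by simp)
      have h2 := ih fun x hx => hs x (by simp [hx])
      gcongr
  have := key M.charpoly.roots fun y hy => by
    by_contra! hlt
    refine hc y hlt ?_
    rw [← Matrix.eval_charpoly]
    exact (Polynomial.mem_roots'.mp hy).2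
  rw [hcard] at this
  exact absurd (this.trans_lt h) (lt_irrefl _)

theorem det_scalar_sub_eq_zero_iff (M : Matrix n n ℂ) (z : ℂ) :
    (Matrix.scalar n z - M).det = 0 ↔ ∃ a, a ≠ 0 ∧ M.mulVec a = z • a := by
  rw [← Matrix.exists_mulVec_eq_zero_iff]
  refine exists_congr fun a => and_congr_right fun _ => ?_
  rw [Matrix.sub_mulVec, sub_eq_zero, eq_comm]
  simp [Matrix.scalar_apply, ← Matrix.smul_one_eq_diagonal, Matrix.smul_mulVec]

/-- If the circle of radius `ρ` about `Λ i` keeps away from the discs of radius `ε` about the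
diagonal entries, then the perturbed matrix has an eigenvalue inside the circle. -/
theorem exists_eigenvector_in_closedBall (Λ : n → ℂ) (E : Matrix n n ℂ) {ε ρ : ℝ} (hε : 0 ≤ ε)
    (hE : ∀ a, ∑ j, ‖E.mulVec a j‖ ^ 2 ≤ ε ^ 2 * ∑ j, ‖a j‖ ^ 2) (i : n) (hρ : 0 ≤ ρ)
    (hfar : ∀ j, ε < |ρ - ‖Λ j - Λ i‖|) :
    ∃ z, ‖z - Λ i‖ ≤ ρ ∧ ∃ a, a ≠ 0 ∧ (Matrix.diagonal Λ + E).mulVec a = z • a := by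
  set D : ℝ → ℂ → ℂ := fun t z =>
    (Matrix.scalar n z - (Matrix.diagonal Λ + (t : ℂ) • E)).det with hD
  have hcont : Continuous fun q : ℝ × ℂ => D q.1 q.2 := by
    refine Continuous.matrix_det ?_
    simp only [Matrix.scalar_apply]
    refine Continuous.sub (Continuous.matrix_diagonal (continuous_pi fun _ => continuous_snd))
      (continuous_const.add ?_)
    exact (Complex.continuous_ofReal.comp continuous_fst).smul continuous_const
  -- Continuation in `t`: this set contains 0, is closed in [0, 1] and is open to the right, hence
  -- contains 1.
  set s : Set ℝ := {t | ∃ z ∈ Metric.closedBall (Λ i) ρ, D t z = 0} with hs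
  have hclosed : IsClosed (s ∩ Set.Icc 0 1) := by
    have hK : IsCompact ((Set.Icc (0 : ℝ) 1 ×ˢ Metric.closedBall (Λ i) ρ) ∩
        {q : ℝ × ℂ | D q.1 q.2 = 0}) :=
      (isCompact_Icc.prod (isCompact_closedBall _ _)).inter_right
        (isClosed_eq hcont continuous_const)
    convert (hK.image continuous_fst).isClosed using 1
    ext t
    constructor
    · rintro ⟨⟨z, hz, hz0⟩, ht⟩
      exact ⟨(t, z), ⟨⟨ht, hz⟩, hz0⟩, rfl⟩
    · rintro ⟨⟨t', z⟩, ⟨⟨ht, hz⟩, hz0⟩, rfl⟩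
      exact ⟨⟨z, hz, hz0⟩, ht⟩
  have hzero : (0 : ℝ) ∈ s := by
    refine ⟨Λ i, Metric.mem_closedBall_self hρ, ?_⟩
    rw [hD, det_scalar_sub_eq_zero_iff]
    exact ⟨Pi.single i 1, by simp, by ext j; by_cases hj : j = i <;> simp [Matrix.mulVec_diagonal, hj]⟩
  have hstep : ∀ t ∈ s ∩ Set.Ico 0 1, s ∈ nhdsWithin t (Set.Ioi t) := by
    rintro t ⟨⟨z, hz, hz0⟩, ht⟩
    -- An eigenvalue on the circle would lie within `ε` of some `Λ j` by Bauer-Fike, which `hfar`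
    -- forbids. So `z` is strictly inside, and a nearby eigenvalue at a slightly larger parameter
    -- stays inside too.
    have hlt : ‖z - Λ i‖ < ρ := by
      refine lt_of_le_of_ne (mem_closedBall_iff_norm.mp hz) fun heq => ?_
      obtain ⟨a, ha, hav⟩ := (det_scalar_sub_eq_zero_iff _ _).mp hz0
      obtain ⟨j, hj⟩ := exists_diag_close_of_eigenvector Λ E hε hE
        (abs_le.mpr ⟨by linarith [ht.1], ht.2.le⟩) ha hav
      have h1 := hfar j
      rw [← heq] at h1
      have h2 := abs_norm_sub_norm_le (z - Λ i) (Λ j - Λ i)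
      rw [sub_sub_sub_cancel_right] at h2
      linarith
    set d := ρ - ‖z - Λ i‖ with hd
    have hdpos : 0 < d := by linarith
    have hc : Continuous fun t' => ‖D t' z‖ :=
      (hcont.comp (continuous_id.prodMk continuous_const)).norm
    have hev : ∀ᶠ t' in nhds t, ‖D t' z‖ < d ^ Fintype.card n := by
      refine hc.tendsto t |>.eventually_lt_const ?_
      rw [hz0, norm_zero]
      positivity
    refine nhdsWithin_le_nhds (hev.mono fun t' ht' => ?_)
    obtain ⟨y, hy, hy0⟩ := exists_eigenvalue_near _ z hdpos ht'
    refine ⟨y, mem_closedBall_iff_norm.mpr ?_, hy0⟩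
    have : ‖y - Λ i‖ ≤ ‖z - y‖ + ‖z - Λ i‖ := by
      rw [norm_sub_rev z y]; exact norm_sub_le_norm_sub_add_norm_sub _ _ _
    linarith
  obtain ⟨z, hz, hz0⟩ := hclosed.Icc_subset_of_forall_mem_nhdsWithin hzero hstep
    (Set.right_mem_Icc.mpr zero_le_one)
  refine ⟨z, mem_closedBall_iff_norm.mp hz, ?_⟩
  simpa [hD] using (det_scalar_sub_eq_zero_iff _ _).mp hz0

/-- Intervals of radius `ε`, one of them centred at `0`, do not cover `[0, R]` if
`R > (2 m - 1) ε`. -/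
theorem exists_gap (d : n → ℝ) (i : n) (hi : d i = 0) {ε R : ℝ} (hε : 0 ≤ ε)
    (hR : (2 * (Fintype.card n : ℝ) - 1) * ε < R) :
    ∃ ρ, 0 ≤ ρ ∧ ρ ≤ R ∧ ∀ j, ε < |ρ - d j| := by
  by_contra! hc
  have hcard : 1 ≤ Fintype.card n := Fintype.card_pos_iff.mpr ⟨i⟩
  -- Only the right half of the interval centred at 0 meets [0, R]. The total length is thus ε + (m
  -- - 1) 2ε, which accounts for the factor 2m - 1.
  have hsub : Set.Icc 0 R ⊆ Set.Icc 0 ε ∪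
      ⋃ j ∈ Finset.univ.erase i, Set.Icc (d j - ε) (d j + ε) := by
    rintro ρ ⟨h0, h1⟩
    obtain ⟨j, hj⟩ := hc ρ h0 h1
    rw [abs_le] at hj
    by_cases hji : j = i
    · left
      subst hji
      exact ⟨h0, by linarith [hj.2]⟩
    · right
      simp only [Set.mem_iUnion]
      exact ⟨j, by simp [hji], by linarith [hj.1], by linarith [hj.2]⟩
  have hvol := (measure_mono (μ := volume) hsub).trans ((measure_union_le _ _).trans
    (add_le_add_right (measure_biUnion_finset_le _ _) _))
  simp only [Real.volume_Icc, sub_zero] at hvol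
  have h2 : ∀ j, d j + ε - (d j - ε) = 2 * ε := fun j => by ring
  simp only [h2, Finset.sum_const, Finset.card_erase_of_mem (Finset.mem_univ i),
    Finset.card_univ] at hvol
  rw [← ENNReal.ofReal_nsmul, ← ENNReal.ofReal_add hε (by positivity),
    ENNReal.ofReal_le_ofReal_iff (by positivity), nsmul_eq_mul, Nat.cast_sub hcard] at hvol
  push_cast at hvol
  linarith

end DiagonalPerturbation

/-! ### Reduction of the saddle point problem to the discretely divergence-free space -/

section SaddlePoint

variable {nu np m : ℕ} {F N Q : Matrix (Fin nu) (Fin nu) ℝ} {B : Matrix (Fin np) (Fin nu) ℝ}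
  {V : Matrix (Fin nu) (Fin m) ℂ} {P : Matrix (Fin np) (Fin m) ℂ} {Λ : Fin m → ℂ}

open Matrix

/-- The generalized saddle point problem, written out by blocks. -/
theorem mem_genSpectrum_iff {α : ℝ} {μ : ℂ} :
    μ ∈ genSpectrum (saddle F B) (massMat α Q B) ↔
      ∃ (u : Fin nu → ℂ) (p : Fin np → ℂ), (u ≠ 0 ∨ p ≠ 0) ∧
        toC F *ᵥ u + (1 - μ * α) • ((toC B)ᵀ *ᵥ p) = -(μ • (toC Q *ᵥ u)) ∧
        (1 - μ * α) • (toC B *ᵥ u) = 0 := by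
  have hA : toC (saddle F B) = fromBlocks (toC F) (toC B)ᵀ (toC B) 0 := by
    ext (i | i) (j | j) <;> simp [toC, saddle]
  have hM : toC (massMat α Q B) =
      fromBlocks (-toC Q) ((α : ℂ) • (toC B)ᵀ) ((α : ℂ) • toC B) 0 := by
    ext (i | i) (j | j) <;> simp [toC, massMat]
  -- Moving the `α` blocks to the left multiplies both `Bᵀ p` and `B u` by the same factor 1 - μα.
  have key : ∀ (u : Fin nu → ℂ) (p : Fin np → ℂ),
      (toC (saddle F B) *ᵥ Sum.elim u p = μ • (toC (massMat α Q B) *ᵥ Sum.elim u p)) ↔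
        (toC F *ᵥ u + (1 - μ * α) • ((toC B)ᵀ *ᵥ p) = -(μ • (toC Q *ᵥ u)) ∧
        (1 - μ * α) • (toC B *ᵥ u) = 0) := by
    intro u p
    rw [hA, hM, fromBlocks_mulVec, fromBlocks_mulVec]
    simp only [Sum.elim_comp_inl, Sum.elim_comp_inr, zero_mulVec, add_zero, neg_mulVec,
      smul_mulVec]
    constructor
    · intro h
      constructor
      · ext i
        have := congrFun h (Sum.inl i)
        simp only [Sum.elim_inl, Pi.add_apply, Pi.smul_apply, Pi.neg_apply, smul_eq_mul] at this ⊢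
        linear_combination this
      · ext i
        have := congrFun h (Sum.inr i)
        simp only [Sum.elim_inr, Pi.smul_apply, smul_eq_mul, Pi.zero_apply] at this ⊢
        linear_combination this
    · rintro ⟨h1, h2⟩
      ext (i | i)
      · have := congrFun h1 i
        simp only [Sum.elim_inl, Pi.add_apply, Pi.smul_apply, Pi.neg_apply, smul_eq_mul] at this ⊢
        linear_combination this
      · have := congrFun h2 i
        simp only [Sum.elim_inr, Pi.smul_apply, smul_eq_mul, Pi.zero_apply] at this ⊢
        linear_combination this
  constructor
  · rintro ⟨z, hz, h⟩
    obtain ⟨u, p, rfl⟩ : ∃ u p, z = Sum.elim u p := ⟨z ∘ Sum.inl, z ∘ Sum.inr, by simp⟩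
    refine ⟨u, p, ?_, (key u p).mp h⟩
    by_contra! hc
    refine hz ?_
    rw [hc.1, hc.2]
    ext (i | i) <;> rfl
  · rintro ⟨u, p, hne, h⟩
    refine ⟨Sum.elim u p, ?_, (key u p).mpr h⟩
    intro h0
    rcases hne with h1 | h1
    · exact h1 (funext fun i => congrFun h0 (Sum.inl i))
    · exact h1 (funext fun i => congrFun h0 (Sum.inr i))

theorem mem_genSpectrum_zero_iff {μ : ℂ} :
    μ ∈ genSpectrum (saddle F B) (massMat 0 Q B) ↔
      ∃ (u : Fin nu → ℂ) (p : Fin np → ℂ), (u ≠ 0 ∨ p ≠ 0) ∧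
        toC F *ᵥ u + (toC B)ᵀ *ᵥ p = -(μ • (toC Q *ᵥ u)) ∧ toC B *ᵥ u = 0 := by
  simp [mem_genSpectrum_iff]

/-- A rightmost eigenvalue exists only if the discrete gradient is injective: a pressure in its
kernel would make every complex number an eigenvalue. -/
theorem IsRightmost.gradient_injective {lam : ℂ}
    (h : IsRightmost (genSpectrum (saddle F B) (massMat 0 Q B)) lam)
    {p : Fin np → ℂ} (hp : (toC B)ᵀ *ᵥ p = 0) : p = 0 := by
  by_contra hne
  have := h.2 (lam + 1) (mem_genSpectrum_zero_iff.mpr ⟨0, p, Or.inr hne, by simp [hp], by simp⟩)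
  simp at this
  linarith

/-- Vectors orthogonal to the kernel of `B` are in the range of the transpose of `B`. -/
theorem exists_transpose_mulVec_eq (A : Matrix (Fin np) (Fin nu) ℂ) (x : Fin nu → ℂ)
    (hx : ∀ w, A *ᵥ w = 0 → x ⬝ᵥ w = 0) : ∃ p, Aᵀ *ᵥ p = x := by
  let ψ : Module.Dual ℂ (Fin nu → ℂ) := dotProductBilin ℂ ℂ x
  have hψ : ψ ∈ (LinearMap.ker A.mulVecLin).dualAnnihilator := by
    rw [Submodule.mem_dualAnnihilator]
    intro w hw
    exact hx w (by simpa using hw)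
  -- The pairing is bilinear, without conjugation, so the range of the transpose is the annihilator
  -- of the kernel. The functional `χ` evaluated on the unit vectors gives `p`.
  rw [← LinearMap.range_dualMap_eq_dualAnnihilator_ker] at hψ
  obtain ⟨χ, hχ⟩ := hψ
  refine ⟨fun i => χ (Pi.single i 1), funext fun j => ?_⟩
  have h1 : χ (A *ᵥ Pi.single j 1) = x j := by
    have := LinearMap.congr_fun hχ (Pi.single j 1)
    simpa [ψ] using this
  rw [← h1, mulVec_single_one, χ.pi_apply_eq_sum_univ]
  simp only [mulVec, dotProduct, transpose_apply, smul_eq_mul, col_apply]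
  exact Finset.sum_congr rfl fun i _ => by
    congr 2
    ext k
    simp [Pi.single_apply, eq_comm]

/-- `V* Q V`. -/
def gram (Q : Matrix (Fin nu) (Fin nu) ℝ) (V : Matrix (Fin nu) (Fin m) ℂ) :
    Matrix (Fin m) (Fin m) ℂ := Vᴴ * toC Q * V

/-- The perturbation of the diagonal matrix of eigenvalues that is caused by `N`. -/
noncomputable def reducedPert (N Q : Matrix (Fin nu) (Fin nu) ℝ) (V : Matrix (Fin nu) (Fin m) ℂ) :
    Matrix (Fin m) (Fin m) ℂ := -((gram Q V)⁻¹ * (Vᴴ * toC N * V))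

theorem star_dotProduct_conjTranspose_mulVec (V : Matrix (Fin nu) (Fin m) ℂ) (b : Fin m → ℂ)
    (x : Fin nu → ℂ) : star b ⬝ᵥ (Vᴴ *ᵥ x) = star (V *ᵥ b) ⬝ᵥ x := by
  rw [star_mulVec, dotProduct_mulVec]

theorem star_dotProduct_congruence (V : Matrix (Fin nu) (Fin m) ℂ) (A : Matrix (Fin nu) (Fin nu) ℂ)
    (b a : Fin m → ℂ) :
    star b ⬝ᵥ ((Vᴴ * A * V) *ᵥ a) = star (V *ᵥ b) ⬝ᵥ (A *ᵥ (V *ᵥ a)) := by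
  rw [← star_dotProduct_conjTranspose_mulVec, mulVec_mulVec, mulVec_mulVec]

/-- If `a` were a nonzero kernel vector, `V a` would be nonzero with vanishing `Q` form. -/
theorem isUnit_det_gram (hQ : ∀ z : Fin nu → ℂ, z ≠ 0 → 0 < (star z ⬝ᵥ (toC Q *ᵥ z)).re)
    (hV : Function.Injective V.mulVec) : IsUnit (gram Q V).det := by
  rw [isUnit_iff_ne_zero]
  intro h0
  obtain ⟨a, ha, h⟩ := exists_mulVec_eq_zero_iff.mpr h0
  have hVa : V *ᵥ a ≠ 0 := fun h => ha (hV (by simpa using h))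
  have := hQ _ hVa
  rw [gram] at h
  rw [← star_dotProduct_congruence, h] at this
  simp at this

theorem gram_mul_reducedPert (hG : IsUnit (gram Q V).det) :
    gram Q V * reducedPert N Q V = -(Vᴴ * toC N * V) := by
  rw [reducedPert, mul_neg, ← Matrix.mul_assoc, mul_nonsing_inv _ hG, Matrix.one_mul]

theorem qNorm_sq_eq (hQ : ∀ z : Fin nu → ℂ, z ≠ 0 → 0 < (star z ⬝ᵥ (toC Q *ᵥ z)).re)
    (z : Fin nu → ℂ) : qNorm Q z ^ 2 = (star z ⬝ᵥ (toC Q *ᵥ z)).re := by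
  rw [qNorm, Real.sq_sqrt]
  by_cases hz : z = 0
  · simp [hz]
  · exact (hQ z hz).le

theorem qNorm_pos (hQ : ∀ z : Fin nu → ℂ, z ≠ 0 → 0 < (star z ⬝ᵥ (toC Q *ᵥ z)).re)
    {z : Fin nu → ℂ} (hz : z ≠ 0) : 0 < qNorm Q z := Real.sqrt_pos.mpr (hQ z hz)

/-- In the velocity norm, the reduced perturbation is bounded by the bound of the form `N`. -/
theorem qNorm_reducedPert_le
    (hQ : ∀ z : Fin nu → ℂ, z ≠ 0 → 0 < (star z ⬝ᵥ (toC Q *ᵥ z)).re)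
    (hV : Function.Injective V.mulVec) {η : ℝ} (hη : 0 ≤ η)
    (hN : ∀ y x : Fin nu → ℂ, ‖star y ⬝ᵥ (toC N *ᵥ x)‖ ≤ η * (qNorm Q y * qNorm Q x))
    (a : Fin m → ℂ) :
    qNorm Q (V *ᵥ (reducedPert N Q V *ᵥ a)) ≤ η * qNorm Q (V *ᵥ a) := by
  set b := reducedPert N Q V *ᵥ a with hb
  have hG := isUnit_det_gram hQ hV
  have h1 : gram Q V *ᵥ b = -((Vᴴ * toC N * V) *ᵥ a) := by
    rw [hb, mulVec_mulVec, gram_mul_reducedPert hG, neg_mulVec]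
  -- Galerkin argument: the defining equation of `b` is tested with `b` itself, and one factor of
  -- the norm of `V b` is then cancelled.
  have h2 : star (V *ᵥ b) ⬝ᵥ (toC Q *ᵥ (V *ᵥ b)) = -(star (V *ᵥ b) ⬝ᵥ (toC N *ᵥ (V *ᵥ a))) := by
    rw [← star_dotProduct_congruence V (toC Q) b b, ← star_dotProduct_congruence V (toC N) b a,
      ← dotProduct_neg, ← h1, gram]
  have h3 : qNorm Q (V *ᵥ b) ^ 2 ≤ η * (qNorm Q (V *ᵥ b) * qNorm Q (V *ᵥ a)) := by
    rw [qNorm_sq_eq hQ, h2]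
    refine (Complex.re_le_norm _).trans ?_
    rw [norm_neg]
    exact hN _ _
  have h0 : 0 ≤ qNorm Q (V *ᵥ b) := Real.sqrt_nonneg _
  have h0' : 0 ≤ qNorm Q (V *ᵥ a) := Real.sqrt_nonneg _
  rcases h0.eq_or_lt with h | h
  · rw [← h]; positivity
  · exact le_of_mul_le_mul_left (by linarith) h

/-- Passing from the velocity norm to Euclidean coordinates costs exactly one factor κ, since only
the ratio of the extreme stretchings of `V` enters. -/
theorem reducedPert_bound
    (hQ : ∀ z : Fin nu → ℂ, z ≠ 0 → 0 < (star z ⬝ᵥ (toC Q *ᵥ z)).re)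
    (hV : Function.Injective V.mulVec) {η κ : ℝ} (hη : 0 ≤ η) (hκ : 0 ≤ κ) (hcond : CondLE Q V κ)
    (hN : ∀ y x : Fin nu → ℂ, ‖star y ⬝ᵥ (toC N *ᵥ x)‖ ≤ η * (qNorm Q y * qNorm Q x))
    (a : Fin m → ℂ) :
    ∑ j, ‖(reducedPert N Q V *ᵥ a) j‖ ^ 2 ≤ (η * κ) ^ 2 * ∑ j, ‖a j‖ ^ 2 := by
  set b := reducedPert N Q V *ᵥ a with hb
  have hle : qNorm Q (V *ᵥ b) ≤ η * qNorm Q (V *ᵥ a) := qNorm_reducedPert_le hQ hV hη hN a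
  set s := ∑ j, ‖a j‖ ^ 2 with hs
  set s' := ∑ j, ‖b j‖ ^ 2 with hs'
  have hs0 : 0 ≤ s := by positivity
  have hs0' : 0 ≤ s' := by positivity
  have hscale : ∀ (c : ℝ) (x : Fin m → ℂ), 0 ≤ c →
      qNorm Q (V *ᵥ ((c : ℂ) • x)) = c * qNorm Q (V *ᵥ x) := by
    intro c x hc
    have h1 : 0 ≤ qNorm Q (V *ᵥ ((c : ℂ) • x)) := Real.sqrt_nonneg _
    have h2 : 0 ≤ qNorm Q (V *ᵥ x) := Real.sqrt_nonneg _
    rw [← sq_eq_sq₀ h1 (mul_nonneg hc h2), mul_pow, qNorm_sq_eq hQ, qNorm_sq_eq hQ]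
    simp only [mulVec_smul, star_smul, smul_dotProduct, dotProduct_smul]
    simp [sq, mul_assoc]
  have hsum : ∀ (c : ℝ) (x : Fin m → ℂ), ∑ j, ‖((c : ℂ) • x) j‖ ^ 2 = c ^ 2 * ∑ j, ‖x j‖ ^ 2 := by
    intro c x
    rw [Finset.mul_sum]
    exact Finset.sum_congr rfl fun j _ => by simp [mul_pow]
  by_cases ha : a = 0
  · have : b = 0 := by rw [hb, ha]; simp
    rw [hs', this]
    simpa using mul_nonneg (sq_nonneg (η * κ)) hs0
  have hVa : 0 < qNorm Q (V *ᵥ a) := qNorm_pos hQ fun h => ha (hV (by simpa using h))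
  -- `CondLE` compares vectors of equal Euclidean length only, so `a` is scaled by the length of `b`
  -- and `b` by the length of `a`.
  have h1 : qNorm Q (V *ᵥ ((√s' : ℂ) • a)) ≤ κ * qNorm Q (V *ᵥ ((√s : ℂ) • b)) :=
    hcond _ _ (by rw [hsum, hsum, Real.sq_sqrt hs0, Real.sq_sqrt hs0', mul_comm])
  rw [hscale _ _ (Real.sqrt_nonneg _), hscale _ _ (Real.sqrt_nonneg _)] at h1
  have h2 : √s' * qNorm Q (V *ᵥ a) ≤ (η * κ * √s) * qNorm Q (V *ᵥ a) := by
    refine h1.trans ?_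
    calc κ * (√s * qNorm Q (V *ᵥ b)) ≤ κ * (√s * (η * qNorm Q (V *ᵥ a))) := by gcongr
      _ = _ := by ring
  have h3 := le_of_mul_le_mul_right h2 hVa
  calc s' = √s' ^ 2 := (Real.sq_sqrt hs0').symm
    _ ≤ (η * κ * √s) ^ 2 := by gcongr
    _ = _ := by rw [mul_pow, Real.sq_sqrt hs0]

/-- A nonzero vector is compared with itself. Its existence matters: for m = 0 the condition holds
for every real κ, even a negative one. -/
theorem one_le_of_condLE (hQ : ∀ z : Fin nu → ℂ, z ≠ 0 → 0 < (star z ⬝ᵥ (toC Q *ᵥ z)).re)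
    (hV : Function.Injective V.mulVec) {κ : ℝ} (hcond : CondLE Q V κ) {a : Fin m → ℂ}
    (ha : a ≠ 0) : 1 ≤ κ := by
  have hVa : 0 < qNorm Q (V *ᵥ a) := qNorm_pos hQ fun h => ha (hV (by simpa using h))
  have := hcond a a rfl
  by_contra! h
  nlinarith

/-- The eigenvalues of the problem with `α = 0` are those of the reduced matrix. -/
theorem mem_genSpectrum_zero_iff_reduced (hEig : IsEigenbasis F B Q V P Λ)
    (hQ : ∀ z : Fin nu → ℂ, z ≠ 0 → 0 < (star z ⬝ᵥ (toC Q *ᵥ z)).re)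
    (hinj : ∀ p : Fin np → ℂ, (toC B)ᵀ *ᵥ p = 0 → p = 0) {μ : ℂ} :
    μ ∈ genSpectrum (saddle (F + N) B) (massMat 0 Q B) ↔
      ∃ a, a ≠ 0 ∧ (diagonal Λ + reducedPert N Q V) *ᵥ a = μ • a := by
  have hG := isUnit_det_gram hQ hEig.injective
  have hadd : toC (F + N) = toC F + toC N := by ext; simp [toC]
  -- The velocities in `V` are discretely divergence free, hence orthogonal to every discrete
  -- pressure gradient. This eliminates the pressure.
  have hBt : Vᴴ * (toC B)ᵀ = 0 := by
    have h1 : (toC B)ᵀ = (toC B)ᴴ := by ext; simp [toC, conjTranspose_apply]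
    rw [h1, ← conjTranspose_mul, hEig.divFree, conjTranspose_zero]
  have hBt' : toC B.transpose = (toC B)ᵀ := rfl
  have hF : Vᴴ * toC F * V = -(gram Q V * diagonal Λ) := by
    have := congrArg (fun M => Vᴴ * M) hEig.momentum
    simp only [Matrix.mul_add, hBt', ← Matrix.mul_assoc, hBt, Matrix.zero_mul, add_zero,
      Matrix.mul_neg] at this
    exact this
  have hFN : Vᴴ * toC (F + N) * V = -(gram Q V * (diagonal Λ + reducedPert N Q V)) := by
    rw [hadd, Matrix.mul_add, Matrix.add_mul, hF, Matrix.mul_add, gram_mul_reducedPert hG]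
    abel
  have hred : ∀ a : Fin m → ℂ, (diagonal Λ + reducedPert N Q V) *ᵥ a = μ • a ↔
      Vᴴ *ᵥ (toC (F + N) *ᵥ (V *ᵥ a) + μ • (toC Q *ᵥ (V *ᵥ a))) = 0 := by
    intro a
    have : Vᴴ *ᵥ (toC (F + N) *ᵥ (V *ᵥ a) + μ • (toC Q *ᵥ (V *ᵥ a))) =
        -(gram Q V *ᵥ ((diagonal Λ + reducedPert N Q V) *ᵥ a - μ • a)) := by
      rw [mulVec_add, mulVec_smul]
      simp only [mulVec_mulVec, ← Matrix.mul_assoc]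
      rw [hFN, mulVec_sub, mulVec_smul, neg_mulVec, mulVec_mulVec, gram]
      abel
    rw [this, neg_eq_zero]
    constructor
    · intro h
      rw [h, sub_self, mulVec_zero]
    · intro h
      have hi := mulVec_injective_iff_isUnit.mpr ((isUnit_iff_isUnit_det _).mpr hG)
      exact sub_eq_zero.mp (hi (h.trans (mulVec_zero _).symm))
  rw [mem_genSpectrum_zero_iff]
  constructor
  · rintro ⟨u, p, hne, h1, h2⟩
    obtain ⟨a, rfl⟩ := hEig.spans u h2
    refine ⟨a, ?_, (hred a).mpr ?_⟩
    · rintro rfl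
      have hp : p = 0 := hinj p (by simpa using h1)
      simp [hp] at hne
    · have : toC (F + N) *ᵥ (V *ᵥ a) + μ • (toC Q *ᵥ (V *ᵥ a)) = -((toC B)ᵀ *ᵥ p) := by
        rw [eq_neg_iff_add_eq_zero, add_right_comm, h1, neg_add_cancel]
      rw [this, mulVec_neg, mulVec_mulVec, hBt, zero_mulVec, neg_zero]
  · rintro ⟨a, ha, h⟩
    rw [hred] at h
    set x := toC (F + N) *ᵥ (V *ᵥ a) + μ • (toC Q *ᵥ (V *ᵥ a)) with hx
    -- The pressure is reconstructed from the residual `x`, which `Vᴴ` annihilates. The range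
    -- criterion uses the bilinear pairing, so kernel vectors must be conjugated; as `B` is real,
    -- its kernel is closed under conjugation.
    obtain ⟨p, hp⟩ := exists_transpose_mulVec_eq (toC B) (-x) fun w hw => by
      have hw' : toC B *ᵥ star w = 0 := by
        have h1 : toC B = (toC B).map star := by ext; simp [toC]
        have h2 : toC B *ᵥ star w = star (toC B *ᵥ w) := by
          rw [star_mulVec, conjTranspose, transpose_map, vecMul_transpose, ← h1]
        rw [h2, hw, star_zero]
      obtain ⟨b, hb⟩ := hEig.spans _ hw'
      have h3 := star_dotProduct_conjTranspose_mulVec V b x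
      rw [h, hb, star_star, dotProduct_zero] at h3
      rw [neg_dotProduct, dotProduct_comm, ← h3, neg_zero]
    refine ⟨V *ᵥ a, p, Or.inl fun h => ha (hEig.injective (by simpa using h)), ?_, ?_⟩
    · rw [hp, hx]; abel
    · rw [mulVec_mulVec, hEig.divFree, zero_mulVec]

/-- Modifying the mass matrix removes no eigenvalue. -/
theorem genSpectrum_zero_subset (α : ℝ) :
    genSpectrum (saddle F B) (massMat 0 Q B) ⊆ genSpectrum (saddle F B) (massMat α Q B) := by
  intro μ hμ
  rw [mem_genSpectrum_zero_iff] at hμ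
  obtain ⟨u, p, hne, h1, h2⟩ := hμ
  rw [mem_genSpectrum_iff]
  by_cases hα : 1 - μ * α = 0
  -- When μα = 1 the pressure drops out of the equations, so any nonzero pressure with zero velocity
  -- is an eigenvector. If the pressure space is trivial, the given solution still works.
  · by_cases hp : ∃ q : Fin np → ℂ, q ≠ 0
    · obtain ⟨q, hq⟩ := hp
      exact ⟨0, q, Or.inr hq, by simp [hα], by simp⟩
    · push Not at hp
      refine ⟨u, p, hne, ?_, by simp [hα]⟩
      rw [← h1, hp p]
      simp
  · refine ⟨u, (1 - μ * α)⁻¹ • p, ?_, ?_, by simp [h2]⟩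
    · rcases hne with h | h
      · exact Or.inl h
      · exact Or.inr (smul_ne_zero (inv_ne_zero hα) h)
    · rw [mulVec_smul, smul_smul, mul_inv_cancel₀ hα, one_smul, h1]

/-- Modifying the mass matrix adds at most the eigenvalue `1 / α`. -/
theorem genSpectrum_subset_insert (α : ℝ) :
    genSpectrum (saddle F B) (massMat α Q B) ⊆
      insert (α : ℂ)⁻¹ (genSpectrum (saddle F B) (massMat 0 Q B)) := by
  intro μ hμ
  rw [mem_genSpectrum_iff] at hμ
  obtain ⟨u, p, hne, h1, h2⟩ := hμ
  by_cases hα : 1 - μ * α = 0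
  · left
    -- This case forces α ≠ 0. For α = 0 the inserted point is the default value 0, which is
    -- harmless since only finiteness is drawn from the inclusion.
    exact eq_inv_of_mul_eq_one_left (sub_eq_zero.mp hα).symm
  · right
    rw [mem_genSpectrum_zero_iff]
    refine ⟨u, (1 - μ * α) • p, ?_, ?_, ?_⟩
    · rcases hne with h | h
      · exact Or.inl h
      · exact Or.inr (smul_ne_zero hα h)
    · rw [mulVec_smul, h1]
    · exact (smul_eq_zero.mp h2).resolve_left hα

theorem finite_eigenvalues (M : Matrix (Fin m) (Fin m) ℂ) :
    {μ : ℂ | ∃ a, a ≠ 0 ∧ M *ᵥ a = μ • a}.Finite := by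
  refine (Module.End.finite_hasEigenvalue (toLin' M)).subset ?_
  rintro μ ⟨a, ha, h⟩
  exact Module.End.hasEigenvalue_of_hasEigenvector
    (Module.End.hasEigenvector_iff.mpr ⟨Module.End.mem_eigenspace_iff.mpr (by simpa using h), ha⟩)

/-- Perturbation of an eigenvalue of a diagonalizable saddle point problem by a matrix `N` that is
bounded in the velocity norm. -/
theorem closest_eigenvalue_bound (hEig : IsEigenbasis F B Q V P Λ)
    (hQ : ∀ z : Fin nu → ℂ, z ≠ 0 → 0 < (star z ⬝ᵥ (toC Q *ᵥ z)).re)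
    {η κ : ℝ} (hη : 0 ≤ η) (hcond : CondLE Q V κ)
    (hN : ∀ y x : Fin nu → ℂ, ‖star y ⬝ᵥ (toC N *ᵥ x)‖ ≤ η * (qNorm Q y * qNorm Q x))
    {lam : ℂ} (hlam : IsRightmost (genSpectrum (saddle F B) (massMat 0 Q B)) lam) (α : ℝ) :
    (∃ lamHat, IsClosest (genSpectrum (saddle (F + N) B) (massMat α Q B)) lam lamHat) ∧
    ∀ lamHat, IsClosest (genSpectrum (saddle (F + N) B) (massMat α Q B)) lam lamHat →
      ‖lamHat - lam‖ ≤ (2 * (m : ℝ) - 1) * (η * κ) ∧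
      ((∀ j, Λ j ≠ lam → 2 * (η * κ) < ‖Λ j - lam‖) → ‖lamHat - lam‖ ≤ η * κ) := by
  have hinj : ∀ p : Fin np → ℂ, (toC B)ᵀ *ᵥ p = 0 → p = 0 := fun p hp => hlam.gradient_injective hp
  -- The reduction is applied with N = 0: the reduced matrix is then diag Λ, so `lam` is one of the
  -- `Λ j`.
  have hlam0 : lam ∈ genSpectrum (saddle (F + 0) B) (massMat 0 Q B) := by simpa using hlam.1
  rw [mem_genSpectrum_zero_iff_reduced hEig hQ hinj] at hlam0
  obtain ⟨a, ha, hav⟩ := hlam0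
  obtain ⟨i, hi⟩ : ∃ i, Λ i = lam := by
    obtain ⟨i, hi⟩ := Function.ne_iff.mp ha
    refine ⟨i, ?_⟩
    have h0 : toC (0 : Matrix (Fin nu) (Fin nu) ℝ) = 0 := by ext; simp [toC]
    have := congrFun hav i
    simp only [reducedPert, h0, Matrix.mul_zero, Matrix.zero_mul, neg_zero, add_zero,
      mulVec_diagonal, Pi.smul_apply, smul_eq_mul] at this
    exact mul_right_cancel₀ hi this
  have hκ : 0 ≤ κ := zero_le_one.trans (one_le_of_condLE hQ hEig.injective hcond ha)
  set ε := η * κ with hε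
  have hε0 : 0 ≤ ε := mul_nonneg hη hκ
  have hE := reducedPert_bound hQ hEig.injective hη hκ hcond hN
  -- Finiteness guarantees that a closest eigenvalue is attained.
  have hfin : (genSpectrum (saddle (F + N) B) (massMat α Q B)).Finite := by
    refine Set.Finite.subset (Set.Finite.insert _ ?_) (genSpectrum_subset_insert α)
    convert finite_eigenvalues (diagonal Λ + reducedPert N Q V) using 1
    ext μ
    exact mem_genSpectrum_zero_iff_reduced hEig hQ hinj
  have hnear : ∀ ρ, 0 ≤ ρ → (∀ j, ε < |ρ - ‖Λ j - lam‖|) →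
      ∃ z ∈ genSpectrum (saddle (F + N) B) (massMat α Q B), ‖z - lam‖ ≤ ρ := by
    intro ρ hρ hfar
    subst hi
    obtain ⟨z, hz, hz'⟩ := exists_eigenvector_in_closedBall Λ _ hε0 hE i hρ hfar
    exact ⟨z, genSpectrum_zero_subset α
      ((mem_genSpectrum_zero_iff_reduced hEig hQ hinj).mpr hz'), hz⟩
  have hgap : ∀ R, (2 * (m : ℝ) - 1) * ε < R →
      ∃ z ∈ genSpectrum (saddle (F + N) B) (massMat α Q B), ‖z - lam‖ ≤ R := by
    intro R hR
    obtain ⟨ρ, h0, h1, h2⟩ := exists_gap (fun j => ‖Λ j - lam‖) i (by simp [hi]) hε0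
      (by simpa using hR)
    obtain ⟨z, hz, hz'⟩ := hnear ρ h0 h2
    exact ⟨z, hz, hz'.trans h1⟩
  constructor
  · obtain ⟨z, hz, -⟩ := hgap _ (lt_add_one _)
    obtain ⟨y, hy, hy'⟩ := Set.exists_min_image _ (fun z => ‖z - lam‖) hfin ⟨z, hz⟩
    exact ⟨y, hy, hy'⟩
  · intro lamHat hclose
    refine ⟨le_of_forall_gt_imp_ge_of_dense fun R hR => ?_, fun hsep => ?_⟩
    · obtain ⟨z, hz, hz'⟩ := hgap R hR
      exact (hclose.2 z hz).trans hz'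
    · refine le_of_forall_gt_imp_ge_of_dense fun R hR => ?_
      -- The radius is taken slightly above ε: it clears the disc about `lam`, and the separation by
      -- more than 2ε leaves room before the other discs. Letting `R` decrease to ε gives the bound.
      obtain ⟨ρ, hρ, hρR, hρfar⟩ : ∃ ρ, ε < ρ ∧ ρ ≤ R ∧ ∀ j, Λ j ≠ lam → ρ < ‖Λ j - lam‖ - ε := by
        have hev : ∀ᶠ ρ in nhdsWithin ε (Set.Ioi ε),
            ρ ≤ R ∧ ∀ j, Λ j ≠ lam → ρ < ‖Λ j - lam‖ - ε := by
          refine nhdsWithin_le_nhds ((eventually_le_nhds hR).and ?_)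
          rw [Filter.eventually_all]
          intro j
          by_cases hj : Λ j = lam
          · simp [hj]
          · exact (eventually_lt_nhds (by linarith [hsep j hj])).mono fun _ h _ => h
        obtain ⟨ρ, h1, h2⟩ := ((eventually_mem_nhdsWithin).and hev).exists
        exact ⟨ρ, h1, h2⟩
      obtain ⟨z, hz, hz'⟩ := hnear ρ (hε0.trans hρ.le) fun j => by
        by_cases hj : Λ j = lam
        · simpa [hj] using hρ.trans_le (le_abs_self ρ)
        · rw [abs_sub_comm]
          exact lt_of_lt_of_le (by linarith [hρfar j hj]) (le_abs_self _)
      exact (hclose.2 z hz).trans (hz'.trans hρR)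

end SaddlePoint

/-! ### Inverse estimates for polynomials -/

section InverseEstimates

/-- The function on the plane defined by a polynomial. -/
@[irreducible] noncomputable def polyFun (p : MvPolynomial (Fin 2) ℝ) (x : Plane) : ℝ := MvPolynomial.eval (fun i => x i) p

theorem contDiff_polyFun (p : MvPolynomial (Fin 2) ℝ) : ContDiff ℝ 1 (polyFun p) := by
  unfold polyFun
  induction p using MvPolynomial.induction_on with
  | C a => simpa using contDiff_const
  | add p q hp hq => simpa using hp.add hq
  | mul_X p i hp => simpa using hp.mul (by fun_prop)

theorem continuous_polyFun (p : MvPolynomial (Fin 2) ℝ) : Continuous (polyFun p) :=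
  (contDiff_polyFun p).continuous

theorem continuous_fderiv_polyFun (p : MvPolynomial (Fin 2) ℝ) :
    Continuous (fderiv ℝ (polyFun p)) :=
  (contDiff_polyFun p).continuous_fderiv one_ne_zero

theorem fderiv_sum_smul {E ι : Type*} [NormedAddCommGroup E] [NormedSpace ℝ E] (s : Finset ι)
    (c : ι → ℝ) (f : ι → E → ℝ) {y : E} (hf : ∀ i ∈ s, DifferentiableAt ℝ (f i) y) :
    fderiv ℝ (∑ i ∈ s, c i • f i) y = ∑ i ∈ s, c i • fderiv ℝ (f i) y :=
  (HasFDerivAt.sum fun i hi => (hf i hi).hasFDerivAt.const_smul (c i)).fderiv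

theorem polyFun_sum_smul {ι : Type*} (s : Finset ι) (c : ι → ℝ)
    (b : ι → MvPolynomial (Fin 2) ℝ) :
    polyFun (∑ i ∈ s, c i • b i) = ∑ i ∈ s, c i • polyFun (b i) := by
  ext x
  simp [polyFun, MvPolynomial.smul_eval]

theorem memLp_polyFun_ball (p : MvPolynomial (Fin 2) ℝ) (σ : ℝ) :
    MemLp (polyFun p) 2 (volume.restrict (Metric.ball (0 : Plane) σ)) := by
  obtain ⟨M, hM⟩ := (isCompact_closedBall (0 : Plane) σ).exists_bound_of_continuousOn
    (continuous_polyFun p).continuousOn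
  have : IsFiniteMeasure (volume.restrict (Metric.ball (0 : Plane) σ)) :=
    ⟨by rw [Measure.restrict_apply_univ]; exact measure_ball_lt_top⟩
  refine MemLp.of_bound (continuous_polyFun p).aestronglyMeasurable M ?_
  exact (ae_restrict_mem Metric.isOpen_ball.measurableSet).mono fun x hx =>
    hM x (Metric.ball_subset_closedBall hx)

/-- The disc contains the square of half-width σ/2, and a polynomial vanishing on a product of
infinite sets is zero. -/
theorem eq_zero_of_polyFun_eq_zero_on_ball {p : MvPolynomial (Fin 2) ℝ} {σ : ℝ} (hσ : 0 < σ)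
    (h : ∀ x ∈ Metric.ball (0 : Plane) σ, polyFun p x = 0) : p = 0 := by
  refine MvPolynomial.funext_set (fun _ => Set.Ioo (-(σ / 2)) (σ / 2))
    (fun _ => Set.Ioo_infinite (by linarith)) fun x hx => ?_
  have hx0 := hx 0 trivial
  have hx1 := hx 1 trivial
  have := h (WithLp.toLp 2 x) (by
    rw [mem_ball_zero_iff, EuclideanSpace.norm_eq, Real.sqrt_lt' hσ]
    simp only [Fin.sum_univ_two, Real.norm_eq_abs, sq_abs]
    have h0 := sq_lt_sq' hx0.1 hx0.2
    have h1 := sq_lt_sq' hx1.1 hx1.2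
    nlinarith)
  simpa [polyFun] using this

theorem norm_toLp_two {X : Type*} [MeasurableSpace X] {μ : Measure X} {f : X → ℝ}
    (hf : MemLp f 2 μ) :
    ‖hf.toLp f‖ = √(∫ x, f x ^ 2 ∂μ) := by
  rw [← Real.sqrt_sq (norm_nonneg _), ← real_inner_self_eq_norm_sq, L2.inner_def]
  congr 1
  refine integral_congr_ae (hf.coeFn_toLp.mono fun x hx => ?_)
  simp [hx, sq]

/-- Polynomials of bounded degree and their gradients are controlled on the unit disc by the `L²`
norm on a small disc. -/
theorem exists_unit_inverse_bound (r : ℕ) {σ : ℝ} (hσ : 0 < σ) :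
    ∃ C : ℝ, 0 < C ∧ ∀ p : MvPolynomial (Fin 2) ℝ, p.totalDegree ≤ r →
      ∀ y ∈ Metric.closedBall (0 : Plane) 1,
        |polyFun p y| ≤ C * √(∫ x in Metric.ball (0 : Plane) σ, polyFun p x ^ 2) ∧
        ‖fderiv ℝ (polyFun p) y‖ ≤ C * √(∫ x in Metric.ball (0 : Plane) σ, polyFun p x ^ 2) := by
  let W := MvPolynomial.restrictTotalDegree (Fin 2) ℝ r
  let b := Module.finBasis ℝ W
  let L : W →ₗ[ℝ] Lp ℝ 2 (volume.restrict (Metric.ball (0 : Plane) σ)) :=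
    { toFun := fun p => (memLp_polyFun_ball p.1 σ).toLp (polyFun p.1)
      map_add' := fun p q => by
        rw [← MemLp.toLp_add]
        congr 1
        ext x
        simp [polyFun]
      map_smul' := fun c p => by
        rw [RingHom.id_apply, ← MemLp.toLp_const_smul]
        congr 1
        ext x
        simp [polyFun, MvPolynomial.smul_eval] }
  have hL : LinearMap.ker (L ∘ₗ b.equivFun.symm.toLinearMap) = ⊥ := by
    rw [LinearMap.ker_eq_bot']
    intro c hc
    have h1 : polyFun (b.equivFun.symm c).1
        =ᵐ[volume.restrict (Metric.ball (0 : Plane) σ)] fun _ => 0 := by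
      rw [← MemLp.toLp_eq_toLp_iff (memLp_polyFun_ball _ σ) MemLp.zero']
      exact hc
    have h2 := Measure.eqOn_open_of_ae_eq h1 Metric.isOpen_ball
      (continuous_polyFun _).continuousOn continuousOn_const
    have h3 : b.equivFun.symm c = 0 :=
      Subtype.ext (eq_zero_of_polyFun_eq_zero_on_ball hσ h2)
    exact (LinearEquiv.map_eq_zero_iff _).mp h3
  -- An injective linear map on a finite-dimensional space is bounded below, so the coefficients in
  -- the basis `b` are controlled by the L² norm on the small disc.
  obtain ⟨K, hK, hanti⟩ := LinearMap.exists_antilipschitzWith _ hL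
  have hval : ∀ i, ∃ A, ∀ y ∈ Metric.closedBall (0 : Plane) 1, ‖polyFun (b i).1 y‖ ≤ A := fun i =>
    (isCompact_closedBall (0 : Plane) 1).exists_bound_of_continuousOn
      (continuous_polyFun _).continuousOn
  have hder : ∀ i, ∃ A, ∀ y ∈ Metric.closedBall (0 : Plane) 1,
      ‖fderiv ℝ (polyFun (b i).1) y‖ ≤ A := fun i =>
    (isCompact_closedBall (0 : Plane) 1).exists_bound_of_continuousOn
      (continuous_fderiv_polyFun _).continuousOn
  choose A hA using hval
  choose A' hA' using hder
  have hA0 : ∀ i, 0 ≤ A i := fun i => (norm_nonneg _).trans (hA i 0 (by simp))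
  have hA0' : ∀ i, 0 ≤ A' i := fun i => (norm_nonneg _).trans (hA' i 0 (by simp))
  have hS : 0 ≤ ∑ i, (A i + A' i) := Finset.sum_nonneg fun i _ => add_nonneg (hA0 i) (hA0' i)
  have hKpos : (0 : ℝ) < K := hK
  -- One constant serves values and gradients alike; the summand 1 keeps it positive.
  refine ⟨K * (1 + ∑ i, (A i + A' i)), by positivity, fun p hp y hy => ?_⟩
  obtain ⟨w, rfl⟩ : ∃ w : W, w.1 = p :=
    ⟨⟨p, (MvPolynomial.mem_restrictTotalDegree _ _ _).mpr hp⟩, rfl⟩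
  set c := b.equivFun w with hc
  have hw : w.1 = ∑ i, c i • (b i).1 := by
    have := congrArg Subtype.val (b.sum_equivFun w)
    simpa only [Submodule.coe_sum, Submodule.coe_smul] using this.symm
  have hnorm : ‖c‖ ≤ K * √(∫ x in Metric.ball (0 : Plane) σ, polyFun w.1 x ^ 2) := by
    have h1 := hanti.le_mul_dist c 0
    rw [map_zero, dist_zero_right, dist_zero_right] at h1
    refine h1.trans_eq ?_
    rw [← norm_toLp_two (memLp_polyFun_ball w.1 σ)]
    simp [hc, L]
  have hci : ∀ i, ‖c i‖ ≤ K * √(∫ x in Metric.ball (0 : Plane) σ, polyFun w.1 x ^ 2) :=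
    fun i => (norm_le_pi_norm c i).trans hnorm
  set I := √(∫ x in Metric.ball (0 : Plane) σ, polyFun w.1 x ^ 2) with hI
  have hI0 : 0 ≤ I := Real.sqrt_nonneg _
  have hfun : polyFun w.1 = ∑ i, c i • polyFun (b i).1 := by
    rw [hw, polyFun_sum_smul]
  have hdiff : ∀ i, DifferentiableAt ℝ (polyFun (b i).1) y := fun i =>
    (contDiff_polyFun _).differentiable one_ne_zero y
  constructor
  · have : polyFun w.1 y = ∑ i, c i • polyFun (b i).1 y := by
      rw [hfun, Finset.sum_apply]; rfl
    rw [← Real.norm_eq_abs, this]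
    refine (norm_sum_le _ _).trans ?_
    calc ∑ i, ‖c i • polyFun (b i).1 y‖ ≤ ∑ i, (K * I) * (A i + A' i) := by
          refine Finset.sum_le_sum fun i _ => ?_
          rw [norm_smul]
          exact mul_le_mul (hci i) ((hA i y hy).trans (by linarith [hA0' i])) (norm_nonneg _)
            (by positivity)
      _ ≤ _ := by
          rw [← Finset.mul_sum]
          nlinarith [mul_nonneg hKpos.le hI0]
  · have : fderiv ℝ (polyFun w.1) y = ∑ i, c i • fderiv ℝ (polyFun (b i).1) y := by
      rw [hfun, fderiv_sum_smul _ _ _ fun i _ => hdiff i]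
    rw [this]
    refine (norm_sum_le _ _).trans ?_
    calc ∑ i, ‖c i • fderiv ℝ (polyFun (b i).1) y‖ ≤ ∑ i, (K * I) * (A i + A' i) := by
          refine Finset.sum_le_sum fun i _ => ?_
          rw [norm_smul]
          exact mul_le_mul (hci i) ((hA' i y hy).trans (by linarith [hA0 i])) (norm_nonneg _)
            (by positivity)
      _ ≤ _ := by
          rw [← Finset.mul_sum]
          nlinarith [mul_nonneg hKpos.le hI0]

/-- An affine change of variables does not raise the degree of a polynomial. -/
theorem exists_polyFun_comp_affine (p : MvPolynomial (Fin 2) ℝ) (x₀ : Plane) (h : ℝ) :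
    ∃ q : MvPolynomial (Fin 2) ℝ, q.totalDegree ≤ p.totalDegree ∧
      ∀ y, polyFun q y = polyFun p (x₀ + h • y) := by
  let f : Fin 2 → MvPolynomial (Fin 2) ℝ := fun i =>
    MvPolynomial.C (x₀ i) + MvPolynomial.C h * MvPolynomial.X i
  have hf : ∀ i, (f i).totalDegree ≤ 1 := fun i => by
    refine (MvPolynomial.totalDegree_add _ _).trans (max_le (by simp) ?_)
    exact (MvPolynomial.totalDegree_mul _ _).trans (by simp)
  refine ⟨MvPolynomial.bind₁ f p, ?_, fun y => ?_⟩
  · rw [MvPolynomial.bind₁, MvPolynomial.aeval_def, MvPolynomial.eval₂_eq]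
    refine MvPolynomial.totalDegree_finsetSum_le fun d hd => ?_
    refine (MvPolynomial.totalDegree_mul _ _).trans ?_
    rw [MvPolynomial.algebraMap_eq, MvPolynomial.totalDegree_C, zero_add]
    refine (MvPolynomial.totalDegree_finsetProd _ _).trans ?_
    refine le_trans (Finset.sum_le_sum fun i _ => ?_) (MvPolynomial.le_totalDegree hd)
    exact (MvPolynomial.totalDegree_pow _ _).trans (by simpa using Nat.mul_le_mul_left (d i) (hf i))
  · rw [polyFun, polyFun, MvPolynomial.bind₁, MvPolynomial.aeval_def, MvPolynomial.eval_eval₂]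
    rw [MvPolynomial.eval, MvPolynomial.coe_eval₂Hom]
    congr 1
    · ext; simp
    · ext i; simp [f]

theorem setIntegral_ball_affine (f : Plane → ℝ) (x₀ : Plane) {h σ : ℝ} (hh : 0 < h) :
    ∫ y in Metric.ball (0 : Plane) σ, f (x₀ + h • y) =
      (h ^ 2)⁻¹ * ∫ x in Metric.ball x₀ (σ * h), f x := by
  rw [Measure.setIntegral_comp_smul_of_pos volume (fun y => f (x₀ + y)) _ hh,
    smul_ball hh.ne', smul_zero, Real.norm_of_nonneg hh.le, finrank_euclideanSpace_fin,
    smul_eq_mul]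
  congr 1
  rw [← (measurePreserving_add_left volume x₀).setIntegral_preimage_emb
    (measurableEmbedding_addLeft x₀) f]
  simp [mul_comm]

/-- Inverse estimates on a disc of radius `h`. -/
theorem exists_inverse_bound (r : ℕ) {σ : ℝ} (hσ : 0 < σ) :
    ∃ C : ℝ, 0 < C ∧ ∀ p : MvPolynomial (Fin 2) ℝ, p.totalDegree ≤ r →
      ∀ (h : ℝ) (x₀ : Plane), 0 < h → ∀ y ∈ Metric.closedBall x₀ h,
        |polyFun p y| ≤ C / h * √(∫ x in Metric.ball x₀ (σ * h), polyFun p x ^ 2) ∧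
        ‖fderiv ℝ (polyFun p) y‖ ≤
          C / h ^ 2 * √(∫ x in Metric.ball x₀ (σ * h), polyFun p x ^ 2) := by
  obtain ⟨C, hC, hb⟩ := exists_unit_inverse_bound r hσ
  refine ⟨C, hC, fun p hp h x₀ hh y hy => ?_⟩
  obtain ⟨q, hq, hqe⟩ := exists_polyFun_comp_affine p x₀ h
  set z : Plane := h⁻¹ • (y - x₀) with hz
  have hyz : x₀ + h • z = y := by
    rw [hz, smul_smul, mul_inv_cancel₀ hh.ne', one_smul, add_sub_cancel]
  have hzb : z ∈ Metric.closedBall (0 : Plane) 1 := by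
    rw [mem_closedBall_zero_iff, hz, norm_smul, norm_inv, Real.norm_of_nonneg hh.le,
      inv_mul_le_one₀ hh]
    exact mem_closedBall_iff_norm.mp hy
  obtain ⟨h1, h2⟩ := hb q (hq.trans hp) z hzb
  -- The Jacobian h² gives one factor 1/h under the root. The gradient gains a second one by the
  -- chain rule.
  have hI : √(∫ x in Metric.ball (0 : Plane) σ, polyFun q x ^ 2) =
      h⁻¹ * √(∫ x in Metric.ball x₀ (σ * h), polyFun p x ^ 2) := by
    simp only [hqe]
    rw [setIntegral_ball_affine (fun x => polyFun p x ^ 2) x₀ hh, Real.sqrt_mul (by positivity),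
      Real.sqrt_inv, Real.sqrt_sq hh.le]
  rw [hI] at h1 h2
  constructor
  · rw [hqe, hyz] at h1
    calc _ ≤ _ := h1
      _ = _ := by ring
  · have hfq : polyFun q = fun y => polyFun p (x₀ + h • y) := funext hqe
    have hd : HasFDerivAt (polyFun q) (h • fderiv ℝ (polyFun p) y) z := by
      have hp' : HasFDerivAt (polyFun p) (fderiv ℝ (polyFun p) y) (x₀ + h • z) := by
        rw [hyz]
        exact ((contDiff_polyFun p).differentiable one_ne_zero y).hasFDerivAt
      rw [hfq]
      have hg : HasFDerivAt (fun y : Plane => x₀ + h • y) (h • ContinuousLinearMap.id ℝ Plane) z :=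
        ((hasFDerivAt_id z).const_smul h).const_add x₀
      refine HasFDerivAt.congr_fderiv (HasFDerivAt.comp (g := polyFun p) z hp' hg) ?_
      ext v
      simp
    rw [hd.fderiv, norm_smul, Real.norm_of_nonneg hh.le] at h2
    calc ‖fderiv ℝ (polyFun p) y‖ = h⁻¹ * (h * ‖fderiv ℝ (polyFun p) y‖) := by
          rw [← mul_assoc, inv_mul_cancel₀ hh.ne', one_mul]
      _ ≤ h⁻¹ * (C * (h⁻¹ * √(∫ x in Metric.ball x₀ (σ * h), polyFun p x ^ 2))) := by gcongr
      _ = _ := by ring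

end InverseEstimates

/-! ### Geometry of elements and the boundary flux -/

namespace Element

theorem convex_region (k : Element) : Convex ℝ k.region := by
  cases k <;> exact convex_convexHull ℝ _

theorem isCompact_region (k : Element) : IsCompact k.region := by
  cases k <;> exact Set.Finite.isCompact_convexHull ℝ (Set.toFinite _)

theorem length_edges_le (k : Element) : k.edges.length ≤ 4 := by
  cases k <;> simp [edges]

theorem mem_region_of_mem_edges {k : Element} {e : Plane × Plane} (he : e ∈ k.edges) :
    e.1 ∈ k.region ∧ e.2 ∈ k.region := by
  cases k with
  | triangle a b c _ =>
    have h : ({a, b, c} : Set Plane) ⊆ convexHull ℝ {a, b, c} := subset_convexHull ℝ _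
    simp only [edges, List.mem_cons, List.not_mem_nil, or_false] at he
    rcases he with rfl | rfl | rfl <;> exact ⟨h (by simp), h (by simp)⟩
  | rectangle a e t _ _ =>
    have h : ({a, a + e, a + e + t • rotCCW e, a + t • rotCCW e} : Set Plane) ⊆ convexHull ℝ _ :=
      subset_convexHull ℝ _
    simp only [edges, List.mem_cons, List.not_mem_nil, or_false] at he
    rcases he with rfl | rfl | rfl | rfl <;> exact ⟨h (by simp), h (by simp)⟩

theorem edge_point_mem_region {k : Element} {e : Plane × Plane} (he : e ∈ k.edges) {τ : ℝ}
    (hτ : τ ∈ Set.Icc (0 : ℝ) 1) : e.1 + τ • (e.2 - e.1) ∈ k.region :=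
  k.convex_region.add_smul_sub_mem (mem_region_of_mem_edges he).1 (mem_region_of_mem_edges he).2 hτ

theorem boundaryFlux_congr {k : Element} {f g : Plane → Plane} (h : ∀ x ∈ k.region, f x = g x) :
    k.boundaryFlux f = k.boundaryFlux g := by
  unfold boundaryFlux
  congr 1
  refine List.map_congr_left fun e he => intervalIntegral.integral_congr fun τ hτ => ?_
  rw [Set.uIcc_of_le zero_le_one] at hτ
  simp only [h _ (edge_point_mem_region he hτ)]

theorem boundaryFlux_add (k : Element) {f g : Plane → Plane} (hf : Continuous f)
    (hg : Continuous g) :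
    k.boundaryFlux (fun x => f x + g x) = k.boundaryFlux f + k.boundaryFlux g := by
  unfold boundaryFlux
  rw [← List.sum_map_add]
  congr 1
  refine List.map_congr_left fun e _ => ?_
  simp only [inner_add_left]
  exact intervalIntegral.integral_add (Continuous.intervalIntegrable (by fun_prop) _ _)
    (Continuous.intervalIntegrable (by fun_prop) _ _)

theorem boundaryFlux_smul (k : Element) (c : ℝ) (f : Plane → Plane) :
    k.boundaryFlux (fun x => c • f x) = c * k.boundaryFlux f := by
  unfold boundaryFlux
  rw [← List.sum_map_mul_left]
  congr 1
  refine List.map_congr_left fun e _ => ?_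
  simp only [real_inner_smul_left]
  exact intervalIntegral.integral_const_mul _ _

theorem norm_rotCW (v : Plane) : ‖rotCW v‖ = ‖v‖ := by
  simp [rotCW, EuclideanSpace.norm_eq, Fin.sum_univ_two, add_comm]

/-- There are at most four edges, and each is no longer than the diameter; the edge length enters
through the norm of the rotated edge vector. -/
theorem abs_boundaryFlux_le {k : Element} {g : Plane → Plane} {M : ℝ}
    (hg : ∀ x ∈ k.region, ‖g x‖ ≤ M) :
    |k.boundaryFlux g| ≤ 4 * (M * Metric.diam k.region) := by
  have key : ∀ e ∈ k.edges,
      |∫ τ in (0 : ℝ)..1, inner ℝ (g (e.1 + τ • (e.2 - e.1))) (rotCW (e.2 - e.1))| ≤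
        M * Metric.diam k.region := by
    intro e he
    have hd : ‖rotCW (e.2 - e.1)‖ ≤ Metric.diam k.region := by
      rw [norm_rotCW, ← dist_eq_norm]
      exact Metric.dist_le_diam_of_mem k.isCompact_region.isBounded
        (mem_region_of_mem_edges he).2 (mem_region_of_mem_edges he).1
    have hM : 0 ≤ M := (norm_nonneg _).trans (hg _ (mem_region_of_mem_edges he).1)
    have := intervalIntegral.norm_integral_le_of_norm_le_const (a := 0) (b := 1)
      (C := M * Metric.diam k.region)
      (f := fun τ => inner ℝ (g (e.1 + τ • (e.2 - e.1))) (rotCW (e.2 - e.1))) fun τ hτ => by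
        rw [Set.uIoc_of_le zero_le_one] at hτ
        refine (norm_inner_le_norm _ _).trans ?_
        exact mul_le_mul (hg _ (edge_point_mem_region he ⟨hτ.1.le, hτ.2⟩)) hd (norm_nonneg _) hM
    simpa using this
  have hlist : ∀ l : List (Plane × Plane), (∀ e ∈ l, e ∈ k.edges) →
      |(l.map fun e => ∫ τ in (0 : ℝ)..1,
        inner ℝ (g (e.1 + τ • (e.2 - e.1))) (rotCW (e.2 - e.1))).sum| ≤
        l.length * (M * Metric.diam k.region) := by
    intro l
    induction l with
    | nil => simp
    | cons e l ih =>
      intro hl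
      rw [List.map_cons, List.sum_cons, List.length_cons]
      refine (abs_add_le _ _).trans ?_
      have h1 := key e (hl e (by simp))
      have h2 := ih fun e' he' => hl e' (by simp [he'])
      push_cast
      linarith
  refine (hlist k.edges fun _ h => h).trans ?_
  have h4 : (k.edges.length : ℝ) ≤ 4 := by exact_mod_cast k.length_edges_le
  obtain ⟨e, he⟩ : ∃ e, e ∈ k.edges := by cases k <;> exact ⟨_, by simp [edges]; left; rfl⟩
  have : 0 ≤ M * Metric.diam k.region := (abs_nonneg _).trans (key e he)
  gcongr

end Element

/-! ### The element form on polynomials -/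

section ElementForm

/-- The curl of a polynomial. -/
noncomputable def curlPoly (Φ : MvPolynomial (Fin 2) ℝ) (x : Plane) : Plane :=
  !₂[-(fderiv ℝ (polyFun Φ) x (unitVec 1)), fderiv ℝ (polyFun Φ) x (unitVec 0)]

theorem continuous_curlPoly (Φ : MvPolynomial (Fin 2) ℝ) : Continuous (curlPoly Φ) := by
  have h := continuous_fderiv_polyFun Φ
  refine (PiLp.continuous_toLp 2 _).comp (continuous_pi fun i => ?_)
  fin_cases i
  · exact (h.clm_apply continuous_const).neg
  · exact h.clm_apply continuous_const

/-- A convex set with interior points has unique derivatives up to its boundary, so the one-sided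
derivative there is that of the polynomial. -/
theorem fderivWithin_region_eq {k : Element} (hk : (interior k.region).Nonempty) {u : Plane → ℝ}
    {p : MvPolynomial (Fin 2) ℝ} (hu : ∀ x ∈ k.region, u x = polyFun p x) {x : Plane}
    (hx : x ∈ k.region) : fderivWithin ℝ u k.region x = fderiv ℝ (polyFun p) x := by
  rw [fderivWithin_congr hu (hu x hx)]
  exact fderivWithin_eq_fderiv (uniqueDiffOn_convex k.convex_region hk x hx)
    ((contDiff_polyFun p).differentiable one_ne_zero x)

theorem curlOn_eq_curlPoly {k : Element} (hk : (interior k.region).Nonempty) {φ : Plane → ℝ}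
    {Φ : MvPolynomial (Fin 2) ℝ} (hφ : ∀ x ∈ k.region, φ x = polyFun Φ x) {x : Plane}
    (hx : x ∈ k.region) : curlOn φ k x = curlPoly Φ x := by
  rw [curlOn, curlPoly, fderivWithin_region_eq hk hφ hx]

theorem polyFun_add (p q : MvPolynomial (Fin 2) ℝ) (x : Plane) :
    polyFun (p + q) x = polyFun p x + polyFun q x := by
  simp [polyFun]

theorem polyFun_smul (c : ℝ) (p : MvPolynomial (Fin 2) ℝ) (x : Plane) :
    polyFun (c • p) x = c * polyFun p x := by
  simp [polyFun, MvPolynomial.smul_eval]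

theorem fderiv_polyFun_add (p q : MvPolynomial (Fin 2) ℝ) (x : Plane) :
    fderiv ℝ (polyFun (p + q)) x = fderiv ℝ (polyFun p) x + fderiv ℝ (polyFun q) x := by
  have h : polyFun (p + q) = polyFun p + polyFun q := funext (polyFun_add p q)
  rw [h]
  exact fderiv_add ((contDiff_polyFun p).differentiable one_ne_zero x)
    ((contDiff_polyFun q).differentiable one_ne_zero x)

theorem fderiv_polyFun_smul (c : ℝ) (p : MvPolynomial (Fin 2) ℝ) (x : Plane) :
    fderiv ℝ (polyFun (c • p)) x = c • fderiv ℝ (polyFun p) x := by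
  have h : polyFun (c • p) = c • polyFun p := funext (polyFun_smul c p)
  rw [h]
  exact fderiv_const_smul ((contDiff_polyFun p).differentiable one_ne_zero x) c

theorem integrableOn_convection (Φ p q : MvPolynomial (Fin 2) ℝ) (k : Element) :
    IntegrableOn (fun x => fderiv ℝ (polyFun p) x (curlPoly Φ x) * polyFun q x) k.region :=
  (((continuous_fderiv_polyFun p).clm_apply (continuous_curlPoly Φ)).mul
    (continuous_polyFun q)).continuousOn.integrableOn_compact k.isCompact_region

theorem continuous_fluxDensity (Φ p q : MvPolynomial (Fin 2) ℝ) :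
    Continuous fun x => (polyFun p x * polyFun q x) • curlPoly Φ x :=
  ((continuous_polyFun p).mul (continuous_polyFun q)).smul (continuous_curlPoly Φ)

/-- The element form on polynomials, as a bilinear map. -/
noncomputable def cPoly (Φ : MvPolynomial (Fin 2) ℝ) (k : Element) :
    MvPolynomial (Fin 2) ℝ →ₗ[ℝ] MvPolynomial (Fin 2) ℝ →ₗ[ℝ] ℝ :=
  LinearMap.mk₂ ℝ
    (fun p q => (∫ x in k.region, fderiv ℝ (polyFun p) x (curlPoly Φ x) * polyFun q x)
      - (1 / 2) * k.boundaryFlux (fun x => (polyFun p x * polyFun q x) • curlPoly Φ x))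
    (fun p p' q => by
      simp only [fderiv_polyFun_add, polyFun_add, add_apply, add_mul, add_smul]
      rw [integral_add (integrableOn_convection Φ p q k) (integrableOn_convection Φ p' q k),
        k.boundaryFlux_add (continuous_fluxDensity Φ p q) (continuous_fluxDensity Φ p' q)]
      ring)
    (fun c p q => by
      simp only [fderiv_polyFun_smul, polyFun_smul, smul_apply, smul_eq_mul,
        mul_assoc, mul_smul c]
      rw [integral_const_mul, k.boundaryFlux_smul]
      ring)
    (fun p q q' => by
      simp only [polyFun_add, mul_add, add_smul]
      rw [integral_add (integrableOn_convection Φ p q k) (integrableOn_convection Φ p q' k),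
        k.boundaryFlux_add (continuous_fluxDensity Φ p q) (continuous_fluxDensity Φ p q')]
      ring)
    (fun c p q => by
      simp only [polyFun_smul, mul_left_comm _ c, smul_eq_mul, mul_smul c]
      rw [integral_const_mul, k.boundaryFlux_smul]
      ring)

/-- On an element everything is polynomial, which transfers bilinearity and the estimate from
`cPoly` to the element form. -/
theorem cElement_eq_cPoly {k : Element} (hk : (interior k.region).Nonempty) {φ u v : Plane → ℝ}
    {Φ p q : MvPolynomial (Fin 2) ℝ} (hφ : ∀ x ∈ k.region, φ x = polyFun Φ x)
    (hu : ∀ x ∈ k.region, u x = polyFun p x) (hv : ∀ x ∈ k.region, v x = polyFun q x) :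
    Discretization.cElement φ k u v = cPoly Φ k p q := by
  rw [Discretization.cElement, cPoly, LinearMap.mk₂_apply]
  congr 1
  · refine setIntegral_congr_fun k.isCompact_region.isClosed.measurableSet fun x hx => ?_
    simp only [fderivWithin_region_eq hk hu hx, curlOn_eq_curlPoly hk hφ hx, hv x hx]
  · congr 1
    refine Element.boundaryFlux_congr fun x hx => ?_
    rw [hu x hx, hv x hx, curlOn_eq_curlPoly hk hφ hx]

/-- The bound of the element form by the `L²` norms, with the inverse of the mesh width. -/
theorem exists_cPoly_bound (r : ℕ) {σ : ℝ} (hσ : 0 < σ) :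
    ∃ C : ℝ, 0 < C ∧ ∀ p q : MvPolynomial (Fin 2) ℝ, p.totalDegree ≤ r → q.totalDegree ≤ r →
      ∀ (h : ℝ) (x₀ : Plane) (k : Element), 0 < h → Metric.diam k.region ≤ h → x₀ ∈ k.region →
      ∀ (Φ : MvPolynomial (Fin 2) ℝ) (M : ℝ), (∀ x ∈ k.region, ‖curlPoly Φ x‖ ≤ M) →
        |cPoly Φ k p q| ≤ C / h * M *
          (√(∫ x in Metric.ball x₀ (σ * h), polyFun p x ^ 2) *
            √(∫ x in Metric.ball x₀ (σ * h), polyFun q x ^ 2)) := by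
  obtain ⟨c, hc, hb⟩ := exists_inverse_bound r hσ
  set ω := volume.real (Metric.ball (0 : Plane) 1) with hω
  have hω0 : 0 ≤ ω := measureReal_nonneg
  -- Two inverse estimates give c². The area of the element is at most ω h², and the 2 is half of
  -- the four edges.
  refine ⟨c ^ 2 * (ω + 2), by positivity, fun p q hp hq h x₀ k hh hdiam hx₀ Φ M hM => ?_⟩
  set a := √(∫ x in Metric.ball x₀ (σ * h), polyFun p x ^ 2) with ha
  set b := √(∫ x in Metric.ball x₀ (σ * h), polyFun q x ^ 2) with hb'
  have ha0 : 0 ≤ a := Real.sqrt_nonneg _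
  have hb0 : 0 ≤ b := Real.sqrt_nonneg _
  have hM0 : 0 ≤ M := (norm_nonneg _).trans (hM x₀ hx₀)
  have hsub : k.region ⊆ Metric.closedBall x₀ h := fun x hx =>
    (Metric.dist_le_diam_of_mem k.isCompact_region.isBounded hx hx₀).trans hdiam
  have hvol : volume.real k.region ≤ h ^ 2 * ω := by
    refine (measureReal_mono hsub measure_closedBall_lt_top.ne).trans_eq ?_
    rw [Measure.addHaar_real_closedBall _ _ hh.le, finrank_euclideanSpace_fin]
  have hpx : ∀ x ∈ k.region, ‖polyFun p x‖ ≤ c / h * a := fun x hx =>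
    (hb p hp h x₀ hh x (hsub hx)).1
  have hqx : ∀ x ∈ k.region, ‖polyFun q x‖ ≤ c / h * b := fun x hx =>
    (hb q hq h x₀ hh x (hsub hx)).1
  have hdp : ∀ x ∈ k.region, ‖fderiv ℝ (polyFun p) x‖ ≤ c / h ^ 2 * a := fun x hx =>
    (hb p hp h x₀ hh x (hsub hx)).2
  -- The powers of h are -2 from the gradient, -1 from the value and 2 from the area.
  have h1 : |∫ x in k.region, fderiv ℝ (polyFun p) x (curlPoly Φ x) * polyFun q x| ≤
      c ^ 2 * ω / h * M * (a * b) := by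
    have := norm_setIntegral_le_of_norm_le_const (μ := volume)
      (k.isCompact_region.measure_lt_top)
      (f := fun x => fderiv ℝ (polyFun p) x (curlPoly Φ x) * polyFun q x)
      (C := (c / h ^ 2 * a * M) * (c / h * b)) fun x hx => by
        rw [norm_mul]
        refine mul_le_mul ?_ (hqx x hx) (norm_nonneg _) (by positivity)
        refine (ContinuousLinearMap.le_opNorm _ _).trans ?_
        exact mul_le_mul (hdp x hx) (hM x hx) (norm_nonneg _) (by positivity)
    rw [Real.norm_eq_abs] at this
    refine this.trans ((mul_le_mul_of_nonneg_left hvol (by positivity)).trans_eq ?_)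
    field_simp
  -- Here each value contributes 1/h and the edge length h, so the boundary term also scales like
  -- 1/h.
  have h2 : |k.boundaryFlux (fun x => (polyFun p x * polyFun q x) • curlPoly Φ x)| ≤
      c ^ 2 * 4 / h * M * (a * b) := by
    have := Element.abs_boundaryFlux_le (k := k)
      (g := fun x => (polyFun p x * polyFun q x) • curlPoly Φ x)
      (M := (c / h * a) * (c / h * b) * M) fun x hx => by
        rw [norm_smul, norm_mul]
        refine mul_le_mul ?_ (hM x hx) (norm_nonneg _) (by positivity)
        exact mul_le_mul (hpx x hx) (hqx x hx) (norm_nonneg _) (by positivity)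
    refine this.trans ?_
    calc 4 * (c / h * a * (c / h * b) * M * Metric.diam k.region)
        ≤ 4 * (c / h * a * (c / h * b) * M * h) := by gcongr
      _ = _ := by field_simp
  rw [cPoly, LinearMap.mk₂_apply]
  refine (abs_sub _ _).trans ?_
  rw [abs_mul, abs_of_pos (by norm_num : (0 : ℝ) < 1 / 2)]
  calc _ ≤ c ^ 2 * ω / h * M * (a * b) + 1 / 2 * (c ^ 2 * 4 / h * M * (a * b)) := by gcongr
    _ = _ := by ring

end ElementForm

theorem IsFEFunction.exists_polyFun {T : Finset Element} {r : ℕ} {u : Plane → ℝ}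
    (hu : IsFEFunction T r u) {k : Element} (hk : k ∈ T) :
    ∃ p : MvPolynomial (Fin 2) ℝ, p.totalDegree ≤ r ∧ ∀ x ∈ k.region, u x = polyFun p x := by
  obtain ⟨p, hp, h⟩ := hu k hk
  exact ⟨p, hp, fun x hx => by rw [h x hx, polyFun]⟩

/-! ### Finite element velocities on the whole mesh -/

namespace Discretization

variable {r : ℕ} (D : Discretization r)

/-- On each element the components of a velocity are polynomials. -/
theorem exists_components {u : Plane → Plane} (hu : u ∈ D.X) {k : Element} (hk : k ∈ D.mesh) :
    ∃ p : Fin 2 → MvPolynomial (Fin 2) ℝ, (∀ i, (p i).totalDegree ≤ r) ∧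
      ∀ i, ∀ x ∈ k.region, u x i = polyFun (p i) x := by
  choose p hp h using fun i => (D.X_fe u hu i).exists_polyFun hk
  exact ⟨p, hp, h⟩

theorem integrableOn_inner {u v : Plane → Plane} (hu : u ∈ D.X) (hv : v ∈ D.X) :
    IntegrableOn (fun x => inner ℝ (u x) (v x)) D.dom := by
  have hcov : IntegrableOn (fun x => inner ℝ (u x) (v x)) (cover D.mesh) := by
    rw [cover, integrableOn_finset_iUnion]
    intro k hk
    obtain ⟨p, -, hp⟩ := D.exists_components hu hk
    obtain ⟨q, -, hq⟩ := D.exists_components hv hk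
    have hc : Continuous fun x => ∑ i, polyFun (p i) x * polyFun (q i) x :=
      continuous_finsetSum _ fun i _ => (continuous_polyFun _).mul (continuous_polyFun _)
    refine IntegrableOn.congr_fun (hc.continuousOn.integrableOn_compact k.isCompact_region)
      (fun x hx => ?_) k.isCompact_region.isClosed.measurableSet
    simp [PiLp.inner_apply, hp _ x hx, hq _ x hx, mul_comm]
  exact hcov.mono_set interior_subset

theorem ball_subset_dom {k : Element} (hk : k ∈ D.mesh) {x₀ : Plane} {ρ : ℝ}
    (h : Metric.ball x₀ ρ ⊆ k.region) : Metric.ball x₀ ρ ⊆ D.dom :=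
  interior_maximal (h.trans (Set.subset_biUnion_of_mem (u := fun k : Element => k.region) hk))
    Metric.isOpen_ball

/-- The squared `L²` norms on discs inside the elements add up to at most the one on the domain. -/
theorem sum_ball_integral_le {u : Plane → Plane} (hu : u ∈ D.X) {x₀ : Element → Plane} {ρ : ℝ}
    (hball : ∀ k ∈ D.mesh, Metric.ball (x₀ k) ρ ⊆ k.region) :
    ∑ k ∈ D.mesh, ∫ x in Metric.ball (x₀ k) ρ, inner ℝ (u x) (u x) ≤
      ∫ x in D.dom, inner ℝ (u x) (u x) := by
  have hint := D.integrableOn_inner hu hu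
  -- Open discs lie in the interiors of their elements, which are disjoint by assumption. Working
  -- with discs avoids any discussion of shared edges.
  have hdisj : Set.Pairwise (D.mesh : Set Element)
      (Function.onFun Disjoint fun k => Metric.ball (x₀ k) ρ) := by
    intro k hk l hl hkl
    exact (D.mesh_disjoint k hk l hl hkl).mono
      (interior_maximal (hball k hk) Metric.isOpen_ball)
      (interior_maximal (hball l hl) Metric.isOpen_ball)
  rw [← integral_biUnion_finset _ (fun k _ => Metric.isOpen_ball.measurableSet) hdisj
    fun k hk => hint.mono_set (D.ball_subset_dom hk (hball k hk))]
  refine setIntegral_mono_set hint (Filter.Eventually.of_forall fun x => real_inner_self_nonneg) ?_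
  exact (Set.iUnion₂_subset fun k hk => D.ball_subset_dom hk (hball k hk)).eventuallyLE

theorem integral_ball_inner_eq {u : Plane → Plane} {k : Element} {x₀ : Plane} {ρ : ℝ}
    (hball : Metric.ball x₀ ρ ⊆ k.region) {p : Fin 2 → MvPolynomial (Fin 2) ℝ}
    (hp : ∀ i, ∀ x ∈ k.region, u x i = polyFun (p i) x) :
    ∫ x in Metric.ball x₀ ρ, inner ℝ (u x) (u x) =
      ∑ i, ∫ x in Metric.ball x₀ ρ, polyFun (p i) x ^ 2 := by
  rw [← integral_finsetSum]
  · refine setIntegral_congr_fun Metric.isOpen_ball.measurableSet fun x hx => ?_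
    simp only [PiLp.inner_apply, hp _ x (hball hx)]
    simp [sq]
  · intro i _
    exact (((continuous_polyFun (p i)).pow 2).continuousOn.integrableOn_compact
      (isCompact_closedBall x₀ ρ)).mono_set Metric.ball_subset_closedBall

/-- The inverse estimate spreads the vanishing from a disc to its whole closed element, and
`X_support` handles the rest of the plane. Hence the L² form is definite on pointwise defined
velocities. -/
theorem eq_zero_of_integral_inner_self {u : Plane → Plane} (hu : u ∈ D.X) {σ h : ℝ} (hσ : 0 < σ)
    (hh : 0 < h) (hq : D.QuasiUniform σ h) (h0 : ∫ x in D.dom, inner ℝ (u x) (u x) ≤ 0) :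
    u = 0 := by
  obtain ⟨c, hc, hb⟩ := exists_inverse_bound r hσ
  funext x
  by_cases hx : x ∈ cover D.mesh
  · simp only [cover, Set.mem_iUnion] at hx
    obtain ⟨k, hk, hxk⟩ := hx
    obtain ⟨hdiam, x₀, hball⟩ := hq k hk
    obtain ⟨p, hpdeg, hp⟩ := D.exists_components hu hk
    have hx₀ : x₀ ∈ k.region := hball (Metric.mem_ball_self (by positivity))
    have hxb : x ∈ Metric.closedBall x₀ h :=
      (Metric.dist_le_diam_of_mem k.isCompact_region.isBounded hxk hx₀).trans hdiam
    have h1 : ∫ x in Metric.ball x₀ (σ * h), inner ℝ (u x) (u x) ≤ 0 :=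
      (setIntegral_mono_set (D.integrableOn_inner hu hu)
        (Filter.Eventually.of_forall fun x => real_inner_self_nonneg)
        (D.ball_subset_dom hk hball).eventuallyLE).trans h0
    rw [integral_ball_inner_eq hball hp] at h1
    ext i
    have hnn : ∀ i, 0 ≤ ∫ x in Metric.ball x₀ (σ * h), polyFun (p i) x ^ 2 := fun i =>
      integral_nonneg fun x => sq_nonneg _
    have h2 : ∫ x in Metric.ball x₀ (σ * h), polyFun (p i) x ^ 2 ≤ 0 :=
      (Finset.single_le_sum (f := fun i => ∫ x in Metric.ball x₀ (σ * h), polyFun (p i) x ^ 2)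
        (fun i _ => hnn i) (Finset.mem_univ i)).trans h1
    have h3 := (hb (p i) (hpdeg i) h x₀ hh x hxb).1
    rw [Real.sqrt_eq_zero'.mpr h2, mul_zero] at h3
    rw [hp i x hxk]
    simpa using h3
  · exact D.X_support u hu x hx

variable {D}

theorem QuasiUniform.interior_nonempty {σ h : ℝ} (hq : D.QuasiUniform σ h) (hσ : 0 < σ)
    (hh : 0 < h) {k : Element} (hk : k ∈ D.mesh) : (interior k.region).Nonempty := by
  obtain ⟨-, x₀, hball⟩ := hq k hk
  exact ⟨x₀, interior_maximal hball Metric.isOpen_ball (Metric.mem_ball_self (by positivity))⟩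

/-- A real supremum bounds its set only if that set is bounded above. Here this follows from
compactness of finitely many elements and continuity of the curl of a polynomial. -/
theorem QuasiUniform.norm_curlOn_le_deltaSup {σ h : ℝ} (hq : D.QuasiUniform σ h) (hσ : 0 < σ)
    (hh : 0 < h) {φ : Plane → ℝ} {s : ℕ} (hφ : IsFEFunction D.mesh s φ) {k : Element}
    (hk : k ∈ D.mesh) {x : Plane} (hx : x ∈ k.region) : ‖curlOn φ k x‖ ≤ D.deltaSup φ := by
  refine le_csSup ?_ ⟨k, hk, x, hx, rfl⟩
  have hset : {y | ∃ k ∈ D.mesh, ∃ x ∈ k.region, y = ‖curlOn φ k x‖} =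
      ⋃ k ∈ D.mesh, (fun x => ‖curlOn φ k x‖) '' k.region := by
    ext y
    simp [eq_comm]
  rw [hset]
  refine (Set.Finite.bddAbove_biUnion D.mesh.finite_toSet).mpr fun k hk => ?_
  obtain ⟨Φ, -, hΦ⟩ := hφ.exists_polyFun hk
  refine k.isCompact_region.bddAbove_image ?_
  refine ((continuous_curlPoly Φ).norm.continuousOn).congr fun x hx => ?_
  simp only [curlOn_eq_curlPoly (hq.interior_nonempty hσ hh hk) hΦ hx]

theorem deltaSup_nonneg (φ : Plane → ℝ) : 0 ≤ D.deltaSup φ :=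
  Real.sSup_nonneg fun y hy => by
    obtain ⟨k, -, x, -, rfl⟩ := hy
    exact norm_nonneg _

/-- The perturbation is bilinear on finite element velocities. -/
theorem QuasiUniform.cForm_sum {σ h : ℝ} (hq : D.QuasiUniform σ h) (hσ : 0 < σ) (hh : 0 < h)
    {φ : Plane → ℝ} {s : ℕ} (hφ : IsFEFunction D.mesh s φ) {n : ℕ} {e : Fin n → Plane → Plane}
    (he : ∀ j, e j ∈ D.X) (y x : Fin n → ℝ) :
    D.cForm φ (∑ j, y j • e j) (∑ l, x l • e l) =
      ∑ j, ∑ l, y j * (x l * D.cForm φ (e j) (e l)) := by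
  have hk : ∀ k ∈ D.mesh, ∀ i : Fin 2,
      cElement φ k (fun z => (∑ j, y j • e j) z i) (fun z => (∑ l, x l • e l) z i) =
        ∑ j, ∑ l, y j * (x l * cElement φ k (fun z => e j z i) (fun z => e l z i)) := by
    intro k hk i
    have hint := hq.interior_nonempty hσ hh hk
    obtain ⟨Φ, -, hΦ⟩ := hφ.exists_polyFun hk
    choose p hpd hp using fun j => D.exists_components (he j) hk
    have hcomb : ∀ c : Fin n → ℝ, ∀ z ∈ k.region,
        (∑ j, c j • e j) z i = polyFun (∑ j, c j • p j i) z := by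
      intro c z hz
      rw [polyFun_sum_smul]
      simp only [Finset.sum_apply, Pi.smul_apply, smul_eq_mul, ← hp _ i z hz, WithLp.ofLp_sum,
        WithLp.ofLp_smul]
    rw [cElement_eq_cPoly hint hΦ (hcomb y) (hcomb x)]
    simp only [map_sum, map_smul, LinearMap.sum_apply, LinearMap.smul_apply, smul_eq_mul]
    simp only [Finset.mul_sum]
    rw [Finset.sum_comm]
    refine Finset.sum_congr rfl fun j _ => Finset.sum_congr rfl fun l _ => ?_
    rw [cElement_eq_cPoly hint hΦ (hp j i) (hp l i)]
    ring
  unfold cForm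
  rw [Finset.sum_congr rfl fun k hk' => Finset.sum_congr rfl fun i _ => hk k hk' i]
  simp only [Finset.mul_sum]
  rw [Finset.sum_congr rfl fun k _ => Finset.sum_comm, Finset.sum_comm]
  refine Finset.sum_congr rfl fun j _ => ?_
  rw [Finset.sum_congr rfl fun k _ => Finset.sum_comm, Finset.sum_comm]

end Discretization

/-- The perturbation is bounded in `L²` by the inverse of the mesh width. -/
theorem exists_cForm_bound (r : ℕ) {σ : ℝ} (hσ : 0 < σ) :
    ∃ C : ℝ, 0 < C ∧ ∀ (D : Discretization r) (h : ℝ), 0 < h → D.QuasiUniform σ h →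
      ∀ (φ : Plane → ℝ) (s : ℕ), IsFEFunction D.mesh s φ → ∀ u ∈ D.X, ∀ v ∈ D.X,
        |D.cForm φ u v| ≤ C / h * D.deltaSup φ *
          (√(∫ x in D.dom, inner ℝ (u x) (u x)) * √(∫ x in D.dom, inner ℝ (v x) (v x))) := by
  obtain ⟨C, hC, hb⟩ := exists_cPoly_bound r hσ
  refine ⟨C, hC, fun D h hh hq φ s hφ u hu v hv => ?_⟩
  have hδ : 0 ≤ D.deltaSup φ := Discretization.deltaSup_nonneg φ
  have hcen : ∀ k, ∃ x₀, k ∈ D.mesh → Metric.ball x₀ (σ * h) ⊆ k.region := fun k => by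
    by_cases hk : k ∈ D.mesh
    · exact (hq k hk).2.imp fun _ h _ => h
    · exact ⟨0, fun h => absurd h hk⟩
  choose x₀ hball using hcen
  have hpol : ∀ w ∈ D.X, ∀ k, ∃ p : Fin 2 → MvPolynomial (Fin 2) ℝ, k ∈ D.mesh →
      (∀ i, (p i).totalDegree ≤ r) ∧ ∀ i, ∀ x ∈ k.region, w x i = polyFun (p i) x := by
    intro w hw k
    by_cases hk : k ∈ D.mesh
    · exact (D.exists_components hw hk).imp fun _ h _ => h
    · exact ⟨0, fun h => absurd h hk⟩
  choose p hp using hpol u hu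
  choose q hq' using hpol v hv
  -- The index is a pair of element and component, so one discrete Cauchy-Schwarz inequality treats
  -- both sums at once.
  let I : (Element → Fin 2 → MvPolynomial (Fin 2) ℝ) → Element × Fin 2 → ℝ := fun p a =>
    ∫ x in Metric.ball (x₀ a.1) (σ * h), polyFun (p a.1 a.2) x ^ 2
  have hI0 : ∀ p a, 0 ≤ I p a := fun p a => integral_nonneg fun x => sq_nonneg _
  have hIsum : ∀ w ∈ D.X, ∀ p : Element → Fin 2 → MvPolynomial (Fin 2) ℝ,
      (∀ k ∈ D.mesh, ∀ i, ∀ x ∈ k.region, w x i = polyFun (p k i) x) →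
      ∑ a ∈ D.mesh ×ˢ Finset.univ, I p a ≤ ∫ x in D.dom, inner ℝ (w x) (w x) := by
    intro w hw p hp
    rw [Finset.sum_product]
    refine le_trans (le_of_eq ?_) (D.sum_ball_integral_le hw hball)
    exact Finset.sum_congr rfl fun k hk =>
      (Discretization.integral_ball_inner_eq (hball k hk) (hp k hk)).symm
  have hterm : ∀ a ∈ D.mesh ×ˢ (Finset.univ : Finset (Fin 2)),
      |Discretization.cElement φ a.1 (fun x => u x a.2) (fun x => v x a.2)| ≤
        C / h * D.deltaSup φ * (√(I p a) * √(I q a)) := by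
    rintro ⟨k, i⟩ ha
    have hk : k ∈ D.mesh := (Finset.mem_product.mp ha).1
    have hint := hq.interior_nonempty hσ hh hk
    obtain ⟨Φ, -, hΦ⟩ := hφ.exists_polyFun hk
    rw [cElement_eq_cPoly hint hΦ ((hp k hk).2 i) ((hq' k hk).2 i)]
    refine hb _ _ ((hp k hk).1 i) ((hq' k hk).1 i) h (x₀ k) k hh (hq k hk).1
      (hball k hk (Metric.mem_ball_self (by positivity))) Φ _ fun x hx => ?_
    rw [← curlOn_eq_curlPoly hint hΦ hx]
    exact hq.norm_curlOn_le_deltaSup hσ hh hφ hk hx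
  unfold Discretization.cForm
  rw [← Finset.sum_product']
  refine (Finset.abs_sum_le_sum_abs _ _).trans ((Finset.sum_le_sum hterm).trans ?_)
  rw [← Finset.mul_sum]
  refine mul_le_mul_of_nonneg_left ?_ (by positivity)
  refine (Real.sum_sqrt_mul_sqrt_le _ (hI0 p) (hI0 q)).trans ?_
  exact mul_le_mul (Real.sqrt_le_sqrt (hIsum u hu p fun k hk => (hp k hk).2))
    (Real.sqrt_le_sqrt (hIsum v hv q fun k hk => (hq' k hk).2)) (Real.sqrt_nonneg _)
    (Real.sqrt_nonneg _)

/-! ### From real forms to complex vectors -/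

section Complexification

open Matrix

variable {n : ℕ} {N Q : Matrix (Fin n) (Fin n) ℝ}

/-- A real matrix as a sesquilinear form, in real and imaginary parts. -/
theorem star_dotProduct_toC_mulVec (A : Matrix (Fin n) (Fin n) ℝ) (y x : Fin n → ℂ) :
    star y ⬝ᵥ (toC A *ᵥ x) =
      (((fun i => (y i).re) ⬝ᵥ (A *ᵥ fun i => (x i).re) +
        (fun i => (y i).im) ⬝ᵥ (A *ᵥ fun i => (x i).im) : ℝ) : ℂ) +
      (((fun i => (y i).re) ⬝ᵥ (A *ᵥ fun i => (x i).im) -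
        (fun i => (y i).im) ⬝ᵥ (A *ᵥ fun i => (x i).re) : ℝ) : ℂ) * Complex.I := by
  simp only [dotProduct, mulVec, Finset.mul_sum, ← Finset.sum_add_distrib, ← Finset.sum_sub_distrib]
  push_cast
  rw [Finset.sum_mul, ← Finset.sum_add_distrib]
  refine Finset.sum_congr rfl fun i _ => ?_
  rw [Finset.sum_mul, ← Finset.sum_add_distrib]
  refine Finset.sum_congr rfl fun j _ => ?_
  apply Complex.ext <;> simp [toC] <;> ring

/-- The real part splits into the real form at the real and imaginary parts of `z`, without any
symmetry of `Q`. -/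
theorem re_star_dotProduct_toC_pos (hQ : ∀ a : Fin n → ℝ, a ≠ 0 → 0 < a ⬝ᵥ (Q *ᵥ a))
    (z : Fin n → ℂ) (hz : z ≠ 0) : 0 < (star z ⬝ᵥ (toC Q *ᵥ z)).re := by
  have hnn : ∀ a : Fin n → ℝ, 0 ≤ a ⬝ᵥ (Q *ᵥ a) := fun a => by
    by_cases ha : a = 0
    · simp [ha]
    · exact (hQ a ha).le
  rw [star_dotProduct_toC_mulVec]
  simp only [Complex.add_re, Complex.ofReal_re, Complex.mul_re, Complex.I_re, Complex.I_im,
    Complex.ofReal_im, mul_zero, zero_mul, sub_zero, add_zero]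
  by_cases hre : (fun i => (z i).re) = 0
  · have him : (fun i => (z i).im) ≠ 0 := fun him =>
      hz (funext fun i => Complex.ext (congrFun hre i) (congrFun him i))
    linarith [hnn fun i => (z i).re, hQ _ him]
  · linarith [hnn fun i => (z i).im, hQ _ hre]

/-- A bound of a real form carries over to complex vectors with a factor `2`. -/
theorem norm_star_dotProduct_toC_le (hQ : ∀ a : Fin n → ℝ, 0 ≤ a ⬝ᵥ (Q *ᵥ a)) {K : ℝ}
    (hK : 0 ≤ K)
    (hN : ∀ a c : Fin n → ℝ, |a ⬝ᵥ (N *ᵥ c)| ≤ K * (√(a ⬝ᵥ (Q *ᵥ a)) * √(c ⬝ᵥ (Q *ᵥ c))))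
    (y x : Fin n → ℂ) :
    ‖star y ⬝ᵥ (toC N *ᵥ x)‖ ≤ 2 * K * (qNorm Q y * qNorm Q x) := by
  -- Since (s + t)² ≤ 2(s² + t²), each of the two vectors costs √2, which together make the factor
  -- 2.
  have hq : ∀ z : Fin n → ℂ, √((fun i => (z i).re) ⬝ᵥ (Q *ᵥ fun i => (z i).re)) +
      √((fun i => (z i).im) ⬝ᵥ (Q *ᵥ fun i => (z i).im)) ≤ √2 * qNorm Q z := by
    intro z
    rw [qNorm, star_dotProduct_toC_mulVec, ← Real.sqrt_mul zero_le_two]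
    refine Real.le_sqrt_of_sq_le ?_
    simp only [Complex.add_re, Complex.ofReal_re, Complex.mul_re, Complex.I_re, Complex.I_im,
      Complex.ofReal_im, mul_zero, zero_mul, sub_zero, add_zero]
    refine (add_sq_le).trans_eq ?_
    rw [Real.sq_sqrt (hQ _), Real.sq_sqrt (hQ _)]
  have hy := hq y
  have hx := hq x
  rw [star_dotProduct_toC_mulVec]
  refine (norm_add_le _ _).trans ?_
  rw [norm_mul, Complex.norm_I, mul_one, Complex.norm_real, Complex.norm_real]
  set a := fun i => (y i).re
  set b := fun i => (y i).im
  set c := fun i => (x i).re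
  set d := fun i => (x i).im
  have h1 := (norm_add_le (a ⬝ᵥ (N *ᵥ c)) (b ⬝ᵥ (N *ᵥ d))).trans (add_le_add (hN a c) (hN b d))
  have h2 := (norm_sub_le (a ⬝ᵥ (N *ᵥ d)) (b ⬝ᵥ (N *ᵥ c))).trans (add_le_add (hN a d) (hN b c))
  have h3 := mul_le_mul hy hx (by positivity) ((by positivity : (0 : ℝ) ≤ _).trans hy)
  calc _ ≤ K * ((√(a ⬝ᵥ (Q *ᵥ a)) + √(b ⬝ᵥ (Q *ᵥ b))) *
        (√(c ⬝ᵥ (Q *ᵥ c)) + √(d ⬝ᵥ (Q *ᵥ d)))) := by linarith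
    _ ≤ K * (√2 * qNorm Q y * (√2 * qNorm Q x)) := mul_le_mul_of_nonneg_left h3 hK
    _ = K * (√2 * √2) * (qNorm Q y * qNorm Q x) := by ring
    _ = _ := by rw [Real.mul_self_sqrt zero_le_two]; ring

end Complexification

/-! ### The mass and perturbation matrices as forms on velocities -/

namespace Discretization

open Matrix

variable {r : ℕ} {D : Discretization r} {nu : ℕ}

theorem dotProduct_matQ_mulVec (e : Module.Basis (Fin nu) ℝ D.X0) (y x : Fin nu → ℝ) :
    y ⬝ᵥ (D.matQ e *ᵥ x) = ∫ z in D.dom,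
      inner ℝ ((∑ j, y j • (e j : Plane → Plane)) z) ((∑ j, x j • (e j : Plane → Plane)) z) := by
  have hint : ∀ j l, IntegrableOn
      (fun z => inner ℝ ((e j : Plane → Plane) z) ((e l : Plane → Plane) z)) D.dom :=
    fun j l => D.integrableOn_inner (e j).2.1 (e l).2.1
  simp only [Finset.sum_apply, Pi.smul_apply, sum_inner, inner_sum, real_inner_smul_left,
    real_inner_smul_right]
  rw [integral_finsetSum _ fun l _ => integrable_finsetSum _ fun j _ =>
    ((hint j l).const_mul _).const_mul _]
  simp only [dotProduct, mulVec, Finset.mul_sum]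
  rw [Finset.sum_comm]
  refine Finset.sum_congr rfl fun l _ => ?_
  rw [integral_finsetSum _ fun j _ => ((hint j l).const_mul _).const_mul _]
  refine Finset.sum_congr rfl fun j _ => ?_
  rw [integral_const_mul, integral_const_mul, matQ, of_apply]
  ring

/-- A coefficient vector with nonpositive mass gives the zero velocity, and the basis is linearly
independent. -/
theorem matQ_pos {σ h : ℝ} (hσ : 0 < σ) (hh : 0 < h) (hq : D.QuasiUniform σ h)
    (e : Module.Basis (Fin nu) ℝ D.X0) (a : Fin nu → ℝ) (ha : a ≠ 0) :
    0 < a ⬝ᵥ (D.matQ e *ᵥ a) := by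
  by_contra! hle
  rw [dotProduct_matQ_mulVec] at hle
  have hmem : ∑ j, a j • (e j : Plane → Plane) ∈ D.X :=
    D.X.sum_mem fun j _ => D.X.smul_mem _ (e j).2.1
  have h0 := D.eq_zero_of_integral_inner_self hmem hσ hh hq hle
  have h1 : ∑ j, a j • e j = 0 := Subtype.ext (by simpa using h0)
  exact ha (funext (Fintype.linearIndependent_iff.mp e.linearIndependent a h1))

theorem dotProduct_matN_mulVec {σ h : ℝ} (hσ : 0 < σ) (hh : 0 < h) (hq : D.QuasiUniform σ h)
    (e : Module.Basis (Fin nu) ℝ D.X0) {φ : Plane → ℝ} {s : ℕ} (hφ : IsFEFunction D.mesh s φ)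
    (y x : Fin nu → ℝ) :
    y ⬝ᵥ (D.matN φ e *ᵥ x) =
      D.cForm φ (∑ j, y j • (e j : Plane → Plane)) (∑ j, x j • (e j : Plane → Plane)) := by
  rw [hq.cForm_sum hσ hh hφ fun j => (e j).2.1]
  simp only [dotProduct, mulVec, Finset.mul_sum, matN, of_apply]
  exact Finset.sum_congr rfl fun j _ => Finset.sum_congr rfl fun l _ => by ring

end Discretization

end NSPerturb

/-! ### The eigenvalue bound for the discretized flow problem -/

theorem mainTheorem1 (r : ℕ) (σ : ℝ) (hσ : 0 < σ) :
    ∃ C : ℝ, 0 < C ∧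
      ∀ (D : NSPerturb.Discretization r) (h : ℝ), 0 < h → D.QuasiUniform σ h →
      ∀ β : ℝ, 0 < β → D.DivStable β →
      ∀ (ν : ℝ) (f w us : NSPerturb.Plane → NSPerturb.Plane)
        (ps : Lp ℝ 2 (volume.restrict (NSPerturb.domain D.mesh))),
        0 < ν → MemLp f 2 (volume.restrict D.dom) → D.IsSteadySolution ν f w us ps →
      ∀ (nu np m : ℕ) (e : Module.Basis (Fin nu) ℝ D.X0) (g : Module.Basis (Fin np) ℝ D.Y)
        (V : Matrix (Fin nu) (Fin m) ℂ) (P : Matrix (Fin np) (Fin m) ℂ) (Λ : Fin m → ℂ) (κ : ℝ),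
        NSPerturb.IsEigenbasis (D.matF ν us e) (D.matB e g) (D.matQ e) V P Λ →
        NSPerturb.CondLE (D.matQ e) V κ →
      ∀ lam : ℂ,
        NSPerturb.IsRightmost
          (NSPerturb.genSpectrum (NSPerturb.saddle (D.matF ν us e) (D.matB e g))
            (NSPerturb.massMat 0 (D.matQ e) (D.matB e g))) lam →
      ∀ (φ : NSPerturb.Plane → ℝ) (s : ℕ), NSPerturb.IsFEFunction D.mesh s φ →
      ∀ (α : ℝ) (S : Set ℂ),
        S = NSPerturb.genSpectrum
              (NSPerturb.saddle (D.matF ν us e + D.matN φ e) (D.matB e g))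
              (NSPerturb.massMat α (D.matQ e) (D.matB e g)) →
        (∃ lamHat, NSPerturb.IsClosest S lam lamHat) ∧
        ∀ lamHat, NSPerturb.IsClosest S lam lamHat →
          ‖lamHat - lam‖ ≤ ((2 * (m : ℝ) - 1) * (C * κ)) / h * D.deltaSup φ ∧
          ((∀ j, Λ j ≠ lam → 2 * ((C * κ) / h * D.deltaSup φ) < ‖Λ j - lam‖) →
            ‖lamHat - lam‖ ≤ (C * κ) / h * D.deltaSup φ) := by
  obtain ⟨C, hC, hb⟩ := NSPerturb.exists_cForm_bound r hσ
  -- The 2 is the price of passing from real to complex coefficient vectors.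
  refine ⟨2 * C, by positivity, ?_⟩
  intro D h hh hq β _ _ ν f w us ps _ _ _ nu np m e g V P Λ κ hEig hcond lam hlam φ s hφ α S hS
  subst hS
  have hδ : 0 ≤ D.deltaSup φ := NSPerturb.Discretization.deltaSup_nonneg φ
  have hpos := NSPerturb.Discretization.matQ_pos hσ hh hq e
  have hnn : ∀ a : Fin nu → ℝ, 0 ≤ a ⬝ᵥ (D.matQ e).mulVec a := fun a => by
    by_cases ha : a = 0
    · simp [ha]
    · exact (hpos a ha).le
  have hmem : ∀ a : Fin nu → ℝ, ∑ j, a j • (e j : NSPerturb.Plane → NSPerturb.Plane) ∈ D.X :=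
    fun a => D.X.sum_mem fun j _ => D.X.smul_mem _ (e j).2.1
  have hN := NSPerturb.norm_star_dotProduct_toC_le (N := D.matN φ e) hnn
    (K := C / h * D.deltaSup φ) (by positivity) fun a c => by
      rw [NSPerturb.Discretization.dotProduct_matN_mulVec hσ hh hq e hφ,
        NSPerturb.Discretization.dotProduct_matQ_mulVec,
        NSPerturb.Discretization.dotProduct_matQ_mulVec]
      exact hb D h hh hq φ s hφ _ (hmem a) _ (hmem c)
  have key := NSPerturb.closest_eigenvalue_bound hEig
    (NSPerturb.re_star_dotProduct_toC_pos hpos) (by positivity) hcond hN hlam α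
  have hε : 2 * (C / h * D.deltaSup φ) * κ = 2 * C * κ / h * D.deltaSup φ := by ring
  rw [hε] at key
  refine ⟨key.1, fun lamHat hclose => ⟨(key.2 lamHat hclose).1.trans_eq (by ring), ?_⟩⟩
  exact (key.2 lamHat hclose).2
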